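/- Let $N\ge 3$, let $2^*=2N/(N-2)$, and let $\Omega\subset\mathbb R^N$ be a bounded domain (a nonempty connected open set). Let $f:\mathbb R\to\mathbb R$ be the odd function determined by $f(0)=0$ and $f'(t)=(1+2f(t)^2)^{-1/2}$. For $4<p\le 2\cdot 2^*$ and $v,w\in H^1_0(\Omega)$ put $$I_p(v)=\frac12\int_\Omega|\nabla v|^2-\frac1p\int_\Omega|f(v)|^p,\qquad I_p'(v)[w]=\int_\Omega\nabla v\cdot\nabla w-\int_\Omega|f(v)|^{p-2}f(v)f'(v)\,w,$$ and let $\mathcal N_p=\{v\in H^1_0(\Omega)\setminus\{0\}: I_p'(v)[v]=0\}$ be the Nehari manifold. Write $I_*=I_{2\cdot 2^*}$ and $\mathcal N_*=\mathcal N_{2\cdot 2^*}$. Then for every $p\in(4,2\cdot2^*)$ the minimum $\mathfrak m_p=\min_{v\in\mathcal N_p}I_p(v)$ is attained, the set $I_*(\mathcal N_*)$ is nonempty and bounded below, so that $m_*=\inf_{v\in\mathcal N_*}I_*(v)$ is a real number, and $$\lim_{p\to 2\cdot2^*,\;p<2\cdot 2^*}\mathfrak m_p=m_*.$$ -/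

import Mathlib

open MeasureTheory Set Filter Topology
open scoped ContDiff

noncomputable section

namespace QuasilinearNehari

/-! ### The change of variable -/

/-- `F(s) = ∫₀ˢ √(1 + 2 τ²) dτ`, the inverse of the change of variable `f`. -/
def changeInv (s : ℝ) : ℝ := ∫ τ in (0 : ℝ)..s, Real.sqrt (1 + 2 * τ ^ 2)

theorem continuous_integrand : Continuous fun τ : ℝ => Real.sqrt (1 + 2 * τ ^ 2) := by
  fun_prop

theorem hasDerivAt_changeInv (s : ℝ) :
    HasDerivAt changeInv (Real.sqrt (1 + 2 * s ^ 2)) s :=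
  intervalIntegral.integral_hasDerivAt_right (continuous_integrand.intervalIntegrable _ _)
    continuous_integrand.aestronglyMeasurable.stronglyMeasurableAtFilter
    continuous_integrand.continuousAt

theorem strictMono_changeInv : StrictMono changeInv := by
  apply strictMono_of_deriv_pos
  intro s
  rw [(hasDerivAt_changeInv s).deriv]
  positivity

theorem changeInv_neg (s : ℝ) : changeInv (-s) = -changeInv s := by
  unfold changeInv
  have h := intervalIntegral.integral_comp_neg (a := 0) (b := s)
    (fun τ : ℝ => Real.sqrt (1 + 2 * τ ^ 2))
  simp only [neg_sq, neg_zero] at h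
  rw [h, intervalIntegral.integral_symm]

theorem le_changeInv {s : ℝ} (hs : 0 ≤ s) : s ≤ changeInv s := by
  have h : ∫ _τ in (0 : ℝ)..s, (1 : ℝ) ≤ changeInv s := by
    refine intervalIntegral.integral_mono_on hs (by simp)
      (continuous_integrand.intervalIntegrable _ _) fun τ _ => ?_
    exact Real.one_le_sqrt.2 (by nlinarith [sq_nonneg τ])
  simpa using h

theorem surjective_changeInv : Function.Surjective changeInv := by
  have hc : Continuous changeInv :=
    continuous_iff_continuousAt.2 fun s => (hasDerivAt_changeInv s).continuousAt
  refine hc.surjective ?_ ?_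
  · exact tendsto_atTop_mono' _ (eventually_ge_atTop 0 |>.mono fun s hs => le_changeInv hs)
      tendsto_id
  · refine tendsto_atBot_mono' _ (eventually_le_atBot 0 |>.mono fun s hs => ?_) tendsto_id
    have h := le_changeInv (s := -s) (by linarith)
    rw [changeInv_neg] at h
    simp only [id]
    linarith

/-- The change of variable `f : ℝ → ℝ`, as the inverse of `F`.  It is the odd function with
`f' = (1 + 2 f²)^(-1/2)`; see `hasDerivAt_change` and `change_neg`. -/
def change (t : ℝ) : ℝ :=
  (strictMono_changeInv.orderIsoOfSurjective changeInv surjective_changeInv).symm t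

theorem changeInv_change (t : ℝ) : changeInv (change t) = t :=
  (strictMono_changeInv.orderIsoOfSurjective changeInv surjective_changeInv).apply_symm_apply t

theorem hasDerivAt_change (t : ℝ) :
    HasDerivAt change (1 / Real.sqrt (1 + 2 * change t ^ 2)) t := by
  have hc : Continuous change :=
    (strictMono_changeInv.orderIsoOfSurjective changeInv surjective_changeInv).symm.continuous
  rw [one_div]
  exact (hasDerivAt_changeInv (change t)).of_local_left_inverse hc.continuousAt
    (by positivity) (Eventually.of_forall changeInv_change)

theorem change_neg (t : ℝ) : change (-t) = -change t := by
  apply strictMono_changeInv.injective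
  rw [changeInv_neg, changeInv_change, changeInv_change]

/-! ### The Sobolev space `H¹₀(Ω)` -/

/-- The Hilbert space `L²(Ω) × L²(Ω; ℝᴺ)`, in which a Sobolev function `v` is represented by the
pair `(v, ∇v)`; it induces the usual norm of `H¹(Ω)`. -/
abbrev L2Pair {N : ℕ} (Ω : Set (EuclideanSpace ℝ (Fin N))) : Type :=
  WithLp 2 (Lp ℝ 2 (volume.restrict Ω) × Lp (EuclideanSpace ℝ (Fin N)) 2 (volume.restrict Ω))

/-- The pairs `(φ, ∇φ)` with `φ` a test function, `φ ∈ C_c^∞(Ω)`. -/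
def testPairs {N : ℕ} (Ω : Set (EuclideanSpace ℝ (Fin N))) : Submodule ℝ (L2Pair Ω) where
  carrier := {w | ∃ φ : EuclideanSpace ℝ (Fin N) → ℝ,
    ContDiff ℝ ∞ φ ∧ HasCompactSupport φ ∧ tsupport φ ⊆ Ω ∧
    w.fst =ᵐ[volume.restrict Ω] φ ∧ w.snd =ᵐ[volume.restrict Ω] gradient φ}
  zero_mem' := by
    refine ⟨0, contDiff_const, HasCompactSupport.zero, by simp, ?_, ?_⟩
    · exact Lp.coeFn_zero _ _ _
    · refine (Lp.coeFn_zero _ _ _).trans (Eventually.of_forall fun x => ?_)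
      simp [gradient]
  add_mem' := by
    rintro v w ⟨φ, hφ, hφc, hφs, hv1, hv2⟩ ⟨ψ, hψ, hψc, hψs, hw1, hw2⟩
    refine ⟨φ + ψ, hφ.add hψ, hφc.add hψc,
      (tsupport_add φ ψ).trans (union_subset hφs hψs), ?_, ?_⟩
    · exact (Lp.coeFn_add _ _).trans (hv1.add hw1)
    · refine (Lp.coeFn_add _ _).trans ((hv2.add hw2).trans (Eventually.of_forall fun x => ?_))
      have h1 : DifferentiableAt ℝ φ x := (hφ.differentiable (by simp)).differentiableAt
      have h2 : DifferentiableAt ℝ ψ x := (hψ.differentiable (by simp)).differentiableAt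
      simp [gradient, fderiv_add h1 h2]
  smul_mem' := by
    rintro c v ⟨φ, hφ, hφc, hφs, hv1, hv2⟩
    refine ⟨c • φ, contDiff_const.smul hφ, hφc.smul_left (f := fun _ => c),
      (tsupport_smul_subset_right (fun _ => c) φ).trans hφs, ?_, ?_⟩
    · exact (Lp.coeFn_smul _ _).trans (hv1.const_smul c)
    · refine (Lp.coeFn_smul _ _).trans
        ((hv2.const_smul c).trans (Eventually.of_forall fun x => ?_))
      have h1 : DifferentiableAt ℝ φ x := (hφ.differentiable (by simp)).differentiableAt
      simp [gradient, fderiv_const_smul h1]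

/-- `H¹₀(Ω)`: the closure of `C_c^∞(Ω)` in the norm of `H¹(Ω)`.  An element `v` has the function
`v.fst ∈ L²(Ω)` and its weak gradient `v.snd ∈ L²(Ω; ℝᴺ)` as components. -/
def H10 {N : ℕ} (Ω : Set (EuclideanSpace ℝ (Fin N))) : Submodule ℝ (L2Pair Ω) :=
  (testPairs Ω).topologicalClosure

/-! ### The functionals, the Nehari manifolds and their levels -/

/-- The Sobolev exponent `2* = 2N / (N - 2)`. -/
def sobolevExp (N : ℕ) : ℝ := 2 * (N : ℝ) / ((N : ℝ) - 2)

/-- The functional `I_p(v) = ½ ∫_Ω |∇v|² - (1/p) ∫_Ω |f(v)|^p`.  For `4 < p ≤ 2·2*` and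
`v ∈ H¹₀(Ω)` the integrals are finite, as `|f(t)|^p ≤ 2^(p/4) |t|^(p/2)` and `p/2 ≤ 2*`. -/
def energy {N : ℕ} (Ω : Set (EuclideanSpace ℝ (Fin N))) (p : ℝ) (v : L2Pair Ω) : ℝ :=
  1 / 2 * (∫ x in Ω, ‖v.snd x‖ ^ 2) - 1 / p * (∫ x in Ω, |change (v.fst x)| ^ p)

/-- The derivative
`I_p'(v)[w] = ∫_Ω ∇v · ∇w - ∫_Ω |f(v)|^(p-2) f(v) f'(v) w`. -/
def energyDeriv {N : ℕ} (Ω : Set (EuclideanSpace ℝ (Fin N))) (p : ℝ) (v w : L2Pair Ω) : ℝ :=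
  (∫ x in Ω, inner ℝ (v.snd x) (w.snd x)) -
    (∫ x in Ω, |change (v.fst x)| ^ (p - 2) * change (v.fst x) * deriv change (v.fst x) * w.fst x)

/-- The Nehari manifold `N_p = {v ∈ H¹₀(Ω) \ {0} : I_p'(v)[v] = 0}`. -/
def nehari {N : ℕ} (Ω : Set (EuclideanSpace ℝ (Fin N))) (p : ℝ) : Set (L2Pair Ω) :=
  {v | v ∈ H10 Ω ∧ v.fst ≠ 0 ∧ energyDeriv Ω p v v = 0}

/-- The level `inf_{v ∈ N_p} I_p(v)`. It is `𝔪_p` for `4 < p < 2·2*` and `m_*` for `p = 2·2*`. -/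
def level {N : ℕ} (Ω : Set (EuclideanSpace ℝ (Fin N))) (p : ℝ) : ℝ :=
  sInf (energy Ω p '' nehari Ω p)

end QuasilinearNehari

end

open MeasureTheory Set Filter Topology
open scoped ContDiff

noncomputable section

namespace QuasilinearNehari

open scoped ENNReal NNReal

variable {N : ℕ} {Ω : Set (EuclideanSpace ℝ (Fin N))}

/-! ### Calculus of the change of variable -/

/-! Write k_p(s) = |f(s)|^(p-2) f(s) f'(s) s, P = 2·2*, and m_p for the level at any p ≤ P.
Everything rests on the behaviour of I_p along rays. From f/2 ≤ s f' ≤ f for s ≥ 0 it follows that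
f(s)²/s and f f' are nondecreasing there, so k_p(ts) ≥ t^(p/2) k_p(s) for t ≥ 1, with the reverse
for t ≤ 1 (`rpow_mul_nehariDensity_le`, `nehariDensity_mul_le`). Since p/2 > 2, every ray meets N_p
(`exists_smul_mem_nehari`), and I_p is maximal on the ray at a point of N_p (`energy_smul_le`). Also
|f|^p ≤ 2 k_p gives I_p ≥ (1/2 - 2/p)‖∇v‖² on N_p.

Attainment for p < P: a minimizing sequence w_n is bounded and, by a Rellich argument
(`exists_subseq_tendsto`), a subsequence converges weakly in gradient and a.e. to some u.
Subcriticality passes ∫|f(t w_n)|^p to the limit, and the lower bound for ‖∇v‖ on N_p makes u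
nonzero. With tu ∈ N_p, I_p(tu) ≤ liminf I_p(t w_n) ≤ lim I_p(w_n) = m_p.

The limit compares I_p and I_* at one point of a ray. Given v ∈ N_p, choose tv ∈ N_*; as y^p/p -
y^P/P is maximal at y = 1, m_* ≤ I_*(tv) ≤ I_p(tv) + (1/p - 1/P)|Ω| ≤ I_p(v) + (1/p - 1/P)|Ω|, with
no control of t (`level_critical_le`). Conversely, fix v ∈ N_*: for p near P there is t ≤ 2 with tv
∈ N_p, and m_p ≤ I_p(tv) ≤ I_*(tv) + o(1) ≤ I_*(v) + o(1), the error being dominated by a function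
of 2v (`eventually_level_lt`). No compactness at the critical exponent is needed. -/

theorem changeInv_zero : changeInv 0 = 0 := by simp [changeInv]

theorem change_zero : change 0 = 0 := by
  apply strictMono_changeInv.injective
  rw [changeInv_change, changeInv_zero]

theorem strictMono_change : StrictMono change :=
  (strictMono_changeInv.orderIsoOfSurjective changeInv surjective_changeInv).symm.strictMono

theorem continuous_change : Continuous change :=
  (strictMono_changeInv.orderIsoOfSurjective changeInv surjective_changeInv).symm.continuous

theorem change_nonneg {s : ℝ} (hs : 0 ≤ s) : 0 ≤ change s := by
  simpa [change_zero] using strictMono_change.monotone hs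

theorem change_pos {s : ℝ} (hs : 0 < s) : 0 < change s := by
  simpa [change_zero] using strictMono_change hs

theorem abs_change (s : ℝ) : |change s| = change |s| := by
  rcases le_total 0 s with h | h
  · rw [abs_of_nonneg h, abs_of_nonneg (change_nonneg h)]
  · rw [abs_of_nonpos h, change_neg, abs_of_nonpos]
    have := change_nonneg (s := -s) (by linarith)
    rw [change_neg] at this; linarith

theorem deriv_change (s : ℝ) : deriv change s = 1 / Real.sqrt (1 + 2 * change s ^ 2) :=
  (hasDerivAt_change s).deriv

theorem deriv_change_pos (s : ℝ) : 0 < deriv change s := by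
  rw [deriv_change]; positivity

theorem deriv_change_neg (s : ℝ) : deriv change (-s) = deriv change s := by
  rw [deriv_change, deriv_change, change_neg, neg_sq]

theorem continuous_deriv_change : Continuous (deriv change) := by
  have : deriv change = fun s => 1 / Real.sqrt (1 + 2 * change s ^ 2) := funext deriv_change
  rw [this]
  refine continuous_const.div ?_ fun s => by positivity
  exact Real.continuous_sqrt.comp (continuous_const.add (continuous_const.mul
    (continuous_change.pow 2)))

theorem changeInv_le {s : ℝ} (hs : 0 ≤ s) : changeInv s ≤ s * Real.sqrt (1 + 2 * s ^ 2) := by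
  have h : changeInv s ≤ ∫ _τ in (0 : ℝ)..s, Real.sqrt (1 + 2 * s ^ 2) := by
    refine intervalIntegral.integral_mono_on hs
      (continuous_integrand.intervalIntegrable _ _) (by simp) fun τ hτ => ?_
    exact Real.sqrt_le_sqrt (by nlinarith [hτ.1, hτ.2])
  simpa using h

theorem sq_le_changeInv {s : ℝ} (hs : 0 ≤ s) : s ^ 2 ≤ Real.sqrt 2 * changeInv s := by
  have h : ∫ τ in (0 : ℝ)..s, Real.sqrt 2 * τ ≤ changeInv s := by
    refine intervalIntegral.integral_mono_on hs
      ((continuous_const.mul continuous_id).intervalIntegrable _ _)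
      (continuous_integrand.intervalIntegrable _ _) fun τ hτ => ?_
    apply Real.le_sqrt_of_sq_le
    rw [mul_pow, Real.sq_sqrt (by norm_num)]; linarith
  rw [intervalIntegral.integral_const_mul, integral_id] at h
  have h2 : Real.sqrt 2 * Real.sqrt 2 = 2 := Real.mul_self_sqrt (by norm_num)
  have h3 := mul_le_mul_of_nonneg_left h (Real.sqrt_nonneg 2)
  nlinarith

/-- The difference of the two sides vanishes at 0 and has derivative 1/√(1 + 2s²). At s = f(t) it
becomes f(t) ≤ 2 t f'(t), the source of every square-root growth bound below. -/
theorem le_two_mul_changeInv {s : ℝ} (hs : 0 ≤ s) :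
    s * Real.sqrt (1 + 2 * s ^ 2) ≤ 2 * changeInv s := by
  have hm : MonotoneOn (fun σ => 2 * changeInv σ - σ * Real.sqrt (1 + 2 * σ ^ 2)) (Ici 0) := by
    have hd : ∀ σ : ℝ, HasDerivAt
        (fun σ => 2 * changeInv σ - σ * Real.sqrt (1 + 2 * σ ^ 2))
        (2 * Real.sqrt (1 + 2 * σ ^ 2) - (1 * Real.sqrt (1 + 2 * σ ^ 2) +
          σ * ((2 * (2 * σ)) / (2 * Real.sqrt (1 + 2 * σ ^ 2))))) σ := by
      intro σ
      refine ((hasDerivAt_changeInv σ).const_mul 2).sub ((hasDerivAt_id σ).mul ?_)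
      refine HasDerivAt.sqrt ?_ (by positivity)
      simpa using ((hasDerivAt_pow 2 σ).const_mul 2).const_add 1
    refine monotoneOn_of_deriv_nonneg (convex_Ici 0)
      (fun σ _ => (hd σ).continuousAt.continuousWithinAt)
      (fun σ _ => (hd σ).differentiableAt.differentiableWithinAt) fun σ _ => ?_
    rw [(hd σ).deriv]
    have h1 : 0 < Real.sqrt (1 + 2 * σ ^ 2) := by positivity
    have h2 : Real.sqrt (1 + 2 * σ ^ 2) ^ 2 = 1 + 2 * σ ^ 2 := Real.sq_sqrt (by positivity)
    have h3 : 2 * Real.sqrt (1 + 2 * σ ^ 2) - (1 * Real.sqrt (1 + 2 * σ ^ 2) +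
          σ * ((2 * (2 * σ)) / (2 * Real.sqrt (1 + 2 * σ ^ 2)))) =
        1 / Real.sqrt (1 + 2 * σ ^ 2) := by
      field_simp
      linarith
    rw [h3]; positivity
  have := hm (mem_Ici.2 le_rfl) (mem_Ici.2 hs) hs
  simp only [changeInv_zero, zero_mul, mul_zero, sub_zero] at this
  linarith

theorem mul_deriv_change_le {s : ℝ} (hs : 0 ≤ s) : s * deriv change s ≤ change s := by
  have h := changeInv_le (change_nonneg hs)
  rw [changeInv_change] at h
  rw [deriv_change, mul_one_div, div_le_iff₀ (by positivity)]
  exact h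

theorem change_le_two_mul {s : ℝ} (hs : 0 ≤ s) : change s ≤ 2 * (s * deriv change s) := by
  have h := le_two_mul_changeInv (change_nonneg hs)
  rw [changeInv_change] at h
  rw [deriv_change, mul_one_div, ← mul_div_assoc, le_div_iff₀ (by positivity)]
  exact h

theorem change_sq_le (s : ℝ) : change s ^ 2 ≤ Real.sqrt 2 * |s| := by
  have h := sq_le_changeInv (change_nonneg (abs_nonneg s))
  rwa [changeInv_change, ← abs_change, sq_abs] at h

/-- The quotient f(σ)²/σ is nondecreasing: the numerator of its derivative is f (2σf' - f) ≥ 0. Thus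
f grows at least like a square root along rays, hence the exponent p/2 later. -/
theorem mul_change_sq_le {s t : ℝ} (hs : 0 ≤ s) (ht : 1 ≤ t) :
    t * change s ^ 2 ≤ change (t * s) ^ 2 := by
  rcases hs.eq_or_lt with rfl | hs
  · simp [change_zero]
  have hm : MonotoneOn (fun σ => change σ ^ 2 / σ) (Ioi 0) := by
    have hd : ∀ σ ∈ Ioi (0 : ℝ), HasDerivAt (fun σ => change σ ^ 2 / σ)
        ((2 * change σ * deriv change σ * σ - change σ ^ 2 * 1) / σ ^ 2) σ := by
      intro σ hσ
      have h1 : HasDerivAt change (deriv change σ) σ :=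
        (hasDerivAt_change σ).differentiableAt.hasDerivAt
      have h2 := (h1.pow 2).div (hasDerivAt_id σ) (ne_of_gt hσ)
      refine h2.congr_deriv ?_
      simp
    refine monotoneOn_of_deriv_nonneg (convex_Ioi 0)
      (fun σ hσ => (hd σ hσ).continuousAt.continuousWithinAt)
      (fun σ hσ => (hd σ (interior_subset hσ)).differentiableAt.differentiableWithinAt)
      fun σ hσ => ?_
    have hσ' : 0 < σ := interior_subset hσ
    rw [(hd σ hσ').deriv]
    have h1 := change_le_two_mul hσ'.le
    have h2 := change_nonneg hσ'.le
    apply div_nonneg _ (sq_nonneg σ)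
    nlinarith
  have hts : 0 < t * s := by positivity
  have h := hm hs hts (by nlinarith)
  simp only at h
  rw [div_le_div_iff₀ hs hts] at h
  have : (t * change s ^ 2) * s ≤ change (t * s) ^ 2 * s := by linarith
  exact le_of_mul_le_mul_right this hs

theorem change_mul_deriv_mono {s t : ℝ} (hs : 0 ≤ s) (hst : s ≤ t) :
    change s * deriv change s ≤ change t * deriv change t := by
  have h0 := change_nonneg hs
  have h1 : change s ≤ change t := strictMono_change.monotone hst
  have h2 : 0 ≤ change t := h0.trans h1
  rw [deriv_change, deriv_change, mul_one_div, mul_one_div,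
    div_le_div_iff₀ (by positivity) (by positivity)]
  refine le_of_abs_le (abs_le_of_sq_le_sq ?_ (by positivity))
  rw [mul_pow, mul_pow, Real.sq_sqrt (by positivity), Real.sq_sqrt (by positivity)]
  nlinarith [mul_self_le_mul_self h0 h1]

/-- The density `|f(s)|^(p-2) f(s) f'(s) s` of `I_p'(v)[v]`. -/
def nehariDensity (p s : ℝ) : ℝ := |change s| ^ (p - 2) * change s * deriv change s * s

theorem nehariDensity_neg (p s : ℝ) : nehariDensity p (-s) = nehariDensity p s := by
  simp only [nehariDensity, change_neg, abs_neg, deriv_change_neg]; ring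

theorem nehariDensity_abs (p s : ℝ) : nehariDensity p |s| = nehariDensity p s := by
  rcases abs_choice s with h | h <;> rw [h]
  exact nehariDensity_neg p s

theorem continuous_nehariDensity {p : ℝ} (hp : 2 ≤ p) : Continuous (nehariDensity p) :=
  (((continuous_change.abs.rpow_const fun _ => Or.inr (by linarith)).mul continuous_change).mul
    continuous_deriv_change).mul continuous_id

theorem continuous_abs_change_rpow {p : ℝ} (hp : 0 ≤ p) :
    Continuous fun s => |change s| ^ p :=
  continuous_change.abs.rpow_const fun _ => Or.inr hp

theorem nehariDensity_nonneg (p s : ℝ) : 0 ≤ nehariDensity p s := by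
  rw [← nehariDensity_abs]
  have := change_nonneg (abs_nonneg s)
  have := (deriv_change_pos |s|).le
  unfold nehariDensity; positivity

theorem change_rpow_eq {p s : ℝ} (hp : 2 ≤ p) (hs : 0 ≤ s) :
    change s ^ p = change s ^ (p - 2) * change s * change s := by
  rcases hp.eq_or_lt with rfl | hp
  · simp [sq]
  · have h := Real.rpow_add_natCast' (x := change s) (y := p - 2) (n := 2) (change_nonneg hs)
      (by push_cast; linarith)
    rw [mul_assoc, ← sq, ← h]
    congr 1; push_cast; ring

theorem nehariDensity_le {p : ℝ} (hp : 2 ≤ p) (s : ℝ) :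
    nehariDensity p s ≤ |change s| ^ p := by
  rw [← nehariDensity_abs, abs_change, change_rpow_eq hp (abs_nonneg s)]
  have h0 := change_nonneg (abs_nonneg s)
  unfold nehariDensity
  rw [abs_of_nonneg h0, mul_assoc]
  have := mul_deriv_change_le (abs_nonneg s)
  gcongr
  linarith

theorem le_two_mul_nehariDensity {p : ℝ} (hp : 2 ≤ p) (s : ℝ) :
    |change s| ^ p ≤ 2 * nehariDensity p s := by
  rw [← nehariDensity_abs, abs_change, change_rpow_eq hp (abs_nonneg s)]
  have h0 := change_nonneg (abs_nonneg s)
  unfold nehariDensity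
  rw [abs_of_nonneg h0]
  have := change_le_two_mul (abs_nonneg s)
  calc change |s| ^ (p - 2) * change |s| * change |s|
      ≤ change |s| ^ (p - 2) * change |s| * (2 * (|s| * deriv change |s|)) := by gcongr
    _ = _ := by ring

/-- Split the density as f^(p-2) · (f f') · s. Under s ↦ ts the factors gain at least t^((p-2)/2), 1
and t. For p > 4 the total power exceeds the power 2 of the Dirichlet term. -/
theorem rpow_mul_nehariDensity_le {p s t : ℝ} (hp : 2 ≤ p) (ht : 1 ≤ t) :
    t ^ (p / 2) * nehariDensity p s ≤ nehariDensity p (t * s) := by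
  wlog hs : 0 ≤ s generalizing s
  · have := this (s := -s) (by linarith)
    rwa [nehariDensity_neg, mul_neg, nehariDensity_neg] at this
  have ht0 : 0 ≤ t := by linarith
  have hts : 0 ≤ t * s := by positivity
  have h0 := change_nonneg hs
  have h1 := change_nonneg hts
  have key : ∀ x : ℝ, 0 ≤ x → x ^ (p - 2) = (x ^ 2) ^ ((p - 2) / 2) := by
    intro x hx
    rw [← Real.rpow_natCast, ← Real.rpow_mul hx]
    congr 1; push_cast; ring
  have h2 : t ^ ((p - 2) / 2) * change s ^ (p - 2) ≤ change (t * s) ^ (p - 2) := by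
    rw [key _ h0, key _ h1, ← Real.mul_rpow ht0 (sq_nonneg _)]
    exact Real.rpow_le_rpow (by positivity) (mul_change_sq_le hs ht) (by linarith)
  have h3 := change_mul_deriv_mono hs (show s ≤ t * s by nlinarith)
  have h4 : t ^ (p / 2) = t ^ ((p - 2) / 2) * t := by
    rw [← Real.rpow_add_one (by linarith)]
    congr 1; ring
  have h5 := (deriv_change_pos s).le
  have h6 := (deriv_change_pos (t * s)).le
  unfold nehariDensity
  rw [abs_of_nonneg h0, abs_of_nonneg h1, h4]
  calc t ^ ((p - 2) / 2) * t * (change s ^ (p - 2) * change s * deriv change s * s)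
      = (t ^ ((p - 2) / 2) * change s ^ (p - 2)) * (change s * deriv change s) * (t * s) := by ring
    _ ≤ change (t * s) ^ (p - 2) * (change (t * s) * deriv change (t * s)) * (t * s) := by
        gcongr
    _ = _ := by ring

theorem nehariDensity_mul_le {p s t : ℝ} (hp : 2 ≤ p) (ht0 : 0 < t) (ht : t ≤ 1) :
    nehariDensity p (t * s) ≤ t ^ (p / 2) * nehariDensity p s := by
  have h := rpow_mul_nehariDensity_le (s := t * s) hp ((one_le_inv₀ ht0).2 ht)
  rw [inv_mul_cancel_left₀ ht0.ne', Real.inv_rpow ht0.le, inv_mul_le_iff₀ (by positivity)] at h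
  exact h

theorem nehariDensity_mul_mono {p s a b : ℝ} (hp : 2 ≤ p) (ha : 0 < a) (hab : a ≤ b) :
    nehariDensity p (a * s) ≤ nehariDensity p (b * s) := by
  have hb : 0 < b := ha.trans_le hab
  have h := nehariDensity_mul_le (s := b * s) hp (div_pos ha hb) ((div_le_one hb).2 hab)
  have h2 : a / b * (b * s) = a * s := by field_simp
  rw [h2] at h
  refine h.trans (mul_le_of_le_one_left (nehariDensity_nonneg _ _) ?_)
  exact Real.rpow_le_one (by positivity) ((div_le_one hb).2 hab) (by linarith)

theorem hasDerivAt_change_mul_rpow_div {p : ℝ} (hp : 2 ≤ p) (s : ℝ) {τ : ℝ} (hs : 0 ≤ s)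
    (hτ : 0 < τ) :
    HasDerivAt (fun r => change (r * s) ^ p / p) (nehariDensity p (τ * s) / τ) τ := by
  have hp0 : p ≠ 0 := by linarith
  have h1 : HasDerivAt (fun r : ℝ => r * s) s τ := by simpa using (hasDerivAt_id τ).mul_const s
  have h2 : HasDerivAt change (deriv change (τ * s)) (τ * s) :=
    (hasDerivAt_change _).differentiableAt.hasDerivAt
  have h3 := ((h2.comp τ h1).rpow_const (p := p) (Or.inr (by linarith))).div_const p
  refine h3.congr_deriv ?_
  have hts : 0 ≤ τ * s := by positivity
  have h0 := change_nonneg hts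
  have h4 : change (τ * s) ^ (p - 1) = change (τ * s) ^ (p - 2) * change (τ * s) := by
    rcases hp.eq_or_lt with rfl | hp
    · norm_num
    · rw [← Real.rpow_add_one' h0 (by linarith)]
      congr 1; ring
  simp only [Function.comp, nehariDensity, abs_of_nonneg h0]
  rw [h4]
  field_simp

/-- The map `t ↦ I_p(tv)` lies, pointwise under the integral, below the parabola that touches it
at `t = 1`. -/
theorem fiber_le {p : ℝ} (hp : 4 ≤ p) (s : ℝ) {t : ℝ} (ht : 0 ≤ t) :
    1 / p * |change s| ^ p - 1 / p * |change (t * s)| ^ p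
      ≤ (1 - t ^ 2) / 2 * nehariDensity p s := by
  wlog hs : 0 ≤ s generalizing s
  · have := this (-s) (by linarith)
    rwa [nehariDensity_neg, mul_neg, change_neg, change_neg, abs_neg, abs_neg] at this
  have hp2 : 2 ≤ p := by linarith
  rw [abs_of_nonneg (change_nonneg hs), abs_of_nonneg (change_nonneg (by positivity))]
  -- The claim is D(1) ≤ D(t). Here D'(r) = k_p(rs)/r - r k_p(s), which is ≤ 0 before r = 1 and ≥ 0
  -- after it because p/2 ≥ 2.
  set D : ℝ → ℝ := fun r => (1 - r ^ 2) / 2 * nehariDensity p s + change (r * s) ^ p / p with hD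
  have hd : ∀ r : ℝ, 0 < r → HasDerivAt D
      (-r * nehariDensity p s + nehariDensity p (r * s) / r) r := by
    intro r hr
    refine HasDerivAt.add ?_ (hasDerivAt_change_mul_rpow_div hp2 s hs hr)
    have := ((((hasDerivAt_pow 2 r).const_sub 1).div_const 2).mul_const (nehariDensity p s))
    refine this.congr_deriv ?_
    push_cast; ring
  have hc : Continuous D := by
    have h := (continuous_change.comp (continuous_mul_const s)).rpow_const (p := p)
      (fun _ => Or.inr (by linarith))
    exact (((continuous_const.sub (continuous_pow 2)).div_const 2).mul_const _).add
      (h.div_const p)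
  have hK := nehariDensity_nonneg p s
  suffices h : D 1 ≤ D t by
    have h' : (1 - 1 ^ 2) / 2 * nehariDensity p s + change (1 * s) ^ p / p ≤
      (1 - t ^ 2) / 2 * nehariDensity p s + change (t * s) ^ p / p := h
    rw [one_mul, div_eq_inv_mul (change s ^ p), div_eq_inv_mul (change (t * s) ^ p)] at h'
    rw [one_div]
    linarith
  rcases le_total t 1 with h1 | h1
  · have hm : AntitoneOn D (Icc 0 1) := by
      refine antitoneOn_of_deriv_nonpos (convex_Icc 0 1) hc.continuousOn
        (fun r hr => ?_) fun r hr => ?_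
      · rw [interior_Icc] at hr
        exact (hd r hr.1).differentiableAt.differentiableWithinAt
      · rw [interior_Icc] at hr
        rw [(hd r hr.1).deriv]
        have h2 := nehariDensity_mul_le (s := s) hp2 hr.1 hr.2.le
        have h3 : r ^ (p / 2) ≤ r ^ (2 : ℝ) :=
          Real.rpow_le_rpow_of_exponent_ge hr.1 hr.2.le (by linarith)
        rw [Real.rpow_two] at h3
        have h4 : nehariDensity p (r * s) / r ≤ r * nehariDensity p s := by
          rw [div_le_iff₀ hr.1]
          nlinarith
        linarith
    exact hm ⟨ht, h1⟩ ⟨zero_le_one, le_rfl⟩ h1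
  · have hm : MonotoneOn D (Ici 1) := by
      refine monotoneOn_of_deriv_nonneg (convex_Ici 1) hc.continuousOn
        (fun r hr => ?_) fun r hr => ?_
      · rw [interior_Ici] at hr
        exact (hd r (zero_lt_one.trans hr)).differentiableAt.differentiableWithinAt
      · rw [interior_Ici, mem_Ioi] at hr
        have hr0 := zero_lt_one.trans hr
        rw [(hd r hr0).deriv]
        have h2 := rpow_mul_nehariDensity_le (s := s) hp2 hr.le
        have h3 : r ^ (2 : ℝ) ≤ r ^ (p / 2) :=
          Real.rpow_le_rpow_of_exponent_le hr.le (by linarith)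
        rw [Real.rpow_two] at h3
        have h4 : r * nehariDensity p s ≤ nehariDensity p (r * s) / r := by
          rw [le_div_iff₀ hr0]
          nlinarith
        linarith
    exact hm (mem_Ici.2 le_rfl) (mem_Ici.2 h1) h1

theorem abs_change_rpow_le {p : ℝ} (hp : 0 ≤ p) (s : ℝ) :
    |change s| ^ p ≤ Real.sqrt 2 ^ (p / 2) * |s| ^ (p / 2) := by
  rw [← Real.mul_rpow (Real.sqrt_nonneg 2) (abs_nonneg s)]
  have h : |change s| ^ p = (change s ^ 2) ^ (p / 2) := by
    rw [← sq_abs, ← Real.rpow_natCast, ← Real.rpow_mul (abs_nonneg _)]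
    congr 1; push_cast; ring
  rw [h]
  exact Real.rpow_le_rpow (by positivity) (change_sq_le s) (by linarith)

theorem nehariDensity_pos {p s : ℝ} (hs : s ≠ 0) : 0 < nehariDensity p s := by
  rw [← nehariDensity_abs]
  have h := abs_pos.2 hs
  have := change_pos h
  have := deriv_change_pos |s|
  unfold nehariDensity; positivity

/-! ### The Sobolev inequality on `H¹₀(Ω)` -/

theorem two_lt_sobolevExp (hN : 3 ≤ N) : 2 < sobolevExp N := by
  have h : (3 : ℝ) ≤ N := by exact_mod_cast hN
  unfold sobolevExp
  rw [lt_div_iff₀ (by linarith)]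
  linarith

theorem norm_gradient (φ : EuclideanSpace ℝ (Fin N) → ℝ) (x : EuclideanSpace ℝ (Fin N)) :
    ‖gradient φ x‖ = ‖fderiv ℝ φ x‖ := by
  simp [gradient]

theorem support_gradient_subset (φ : EuclideanSpace ℝ (Fin N) → ℝ) :
    Function.support (gradient φ) ⊆ tsupport φ := by
  intro x hx
  apply support_fderiv_subset ℝ
  rw [Function.mem_support] at hx ⊢
  contrapose! hx
  rw [← norm_eq_zero, norm_gradient, hx, norm_zero]

theorem eLpNorm_fst (v : L2Pair Ω) : eLpNorm v.fst 2 (volume.restrict Ω) = ENNReal.ofReal ‖v.fst‖ := by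
  rw [Lp.norm_def, ENNReal.ofReal_toReal (Lp.eLpNorm_ne_top _)]

theorem eLpNorm_snd (v : L2Pair Ω) : eLpNorm v.snd 2 (volume.restrict Ω) = ENNReal.ofReal ‖v.snd‖ := by
  rw [Lp.norm_def, ENNReal.ofReal_toReal (Lp.eLpNorm_ne_top _)]

theorem integral_inner_snd (v w : L2Pair Ω) :
    ∫ x in Ω, inner ℝ (v.snd x) (w.snd x) = inner ℝ v.snd w.snd :=
  (L2.inner_def _ _).symm

theorem integral_inner_snd_self (v : L2Pair Ω) :
    ∫ x in Ω, inner ℝ (v.snd x) (v.snd x) = ‖v.snd‖ ^ 2 := by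
  rw [integral_inner_snd, real_inner_self_eq_norm_sq]

theorem integral_norm_snd_sq (v : L2Pair Ω) : ∫ x in Ω, ‖v.snd x‖ ^ 2 = ‖v.snd‖ ^ 2 := by
  rw [← integral_inner_snd_self]
  simp only [real_inner_self_eq_norm_sq]

theorem exists_ae_tendsto_of_tendsto {w : ℕ → L2Pair Ω} {v : L2Pair Ω}
    (h : Tendsto (fun n => (w n).fst) atTop (𝓝 v.fst)) :
    ∃ ns : ℕ → ℕ, StrictMono ns ∧
      ∀ᵐ x ∂(volume.restrict Ω), Tendsto (fun n => (w (ns n)).fst x) atTop (𝓝 (v.fst x)) :=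
  (tendstoInMeasure_of_tendsto_Lp h).exists_seq_tendsto_ae

theorem exists_testPairs_tendsto {v : L2Pair Ω} (hv : v ∈ H10 Ω) :
    ∃ w : ℕ → L2Pair Ω, (∀ n, w n ∈ testPairs Ω) ∧ Tendsto w atTop (𝓝 v) := by
  have : v ∈ closure (testPairs Ω : Set (L2Pair Ω)) := hv
  exact mem_closure_iff_seq_limit.1 this

theorem L2Pair.continuous_fst : Continuous fun v : L2Pair Ω => v.fst :=
  WithLp.prod_continuous_ofLp 2 _ _ |>.fst

theorem L2Pair.continuous_snd : Continuous fun v : L2Pair Ω => v.snd :=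
  WithLp.prod_continuous_ofLp 2 _ _ |>.snd

/-- For test functions this is the Gagliardo–Nirenberg–Sobolev inequality; it passes to the closure
by Fatou's lemma along an a.e. convergent subsequence. -/
theorem exists_sobolev_eLpNorm (hN : 3 ≤ N) :
    ∃ C : ℝ≥0, ∀ v ∈ H10 Ω, eLpNorm v.fst (ENNReal.ofReal (sobolevExp N)) (volume.restrict Ω)
      ≤ C * ENNReal.ofReal ‖v.snd‖ := by
  have hN' : (3 : ℝ) ≤ N := by exact_mod_cast hN
  obtain ⟨C, hC⟩ : ∃ C : ℝ≥0, ∀ v ∈ testPairs Ω,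
      eLpNorm v.fst (ENNReal.ofReal (sobolevExp N)) (volume.restrict Ω)
      ≤ C * ENNReal.ofReal ‖v.snd‖ := by
    refine ⟨eLpNormLESNormFDerivOfEqInnerConst
      (volume : Measure (EuclideanSpace ℝ (Fin N))) ((2 : ℝ≥0) : ℝ), ?_⟩
    rintro v ⟨φ, hφ, hφc, hφs, h1, h2⟩
    have h := eLpNorm_le_eLpNorm_fderiv_of_eq_inner
      (volume : Measure (EuclideanSpace ℝ (Fin N))) (u := φ) (hφ.of_le (by simp)) hφc
      (p := 2) (p' := (sobolevExp N).toNNReal) (by norm_num) (by simp; omega) (by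
        rw [finrank_euclideanSpace_fin, Real.coe_toNNReal _ (by linarith [two_lt_sobolevExp hN])]
        unfold sobolevExp
        push_cast
        field_simp)
    rw [eLpNorm_congr_ae h1, ← eLpNorm_snd, eLpNorm_congr_ae h2,
      eLpNorm_restrict_eq_of_support_subset ((support_gradient_subset φ).trans hφs)]
    refine (eLpNorm_mono_measure _ Measure.restrict_le_self).trans (h.trans (le_of_eq ?_))
    congr 1
    exact eLpNorm_congr_norm_ae (Eventually.of_forall fun x => (norm_gradient φ x).symm)
  refine ⟨C, fun v hv => ?_⟩
  obtain ⟨w, hw, hwv⟩ := exists_testPairs_tendsto hv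
  obtain ⟨ns, hns, hae⟩ := exists_ae_tendsto_of_tendsto ((L2Pair.continuous_fst.tendsto v).comp hwv)
  refine (Lp.eLpNorm_lim_le_liminf_eLpNorm
    (fun n => (Lp.aestronglyMeasurable (w (ns n)).fst)) _ hae).trans ?_
  have hlim : Tendsto (fun n => (C : ℝ≥0∞) * ENNReal.ofReal ‖(w (ns n)).snd‖) atTop
      (𝓝 (C * ENNReal.ofReal ‖v.snd‖)) := by
    refine ENNReal.Tendsto.const_mul ?_ (Or.inr ENNReal.coe_ne_top)
    exact ENNReal.tendsto_ofReal
      (((continuous_norm.comp L2Pair.continuous_snd).tendsto v).comp (hwv.comp hns.tendsto_atTop))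
  rw [← hlim.liminf_eq]
  exact liminf_le_liminf (Eventually.of_forall fun n => hC _ (hw _))

theorem isFiniteMeasure_of_isBounded (hΩb : Bornology.IsBounded Ω) :
    IsFiniteMeasure (volume.restrict Ω) :=
  isFiniteMeasure_restrict.2 hΩb.measure_lt_top.ne

theorem exists_sobolev (hN : 3 ≤ N) (hΩb : Bornology.IsBounded Ω) {r : ℝ} (hr : 0 < r)
    (hrq : r ≤ sobolevExp N) :
    ∃ C : ℝ, 0 ≤ C ∧ ∀ v ∈ H10 Ω, Integrable (fun x => |v.fst x| ^ r) (volume.restrict Ω) ∧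
      ∫ x in Ω, |v.fst x| ^ r ≤ C * ‖v.snd‖ ^ r := by
  have := isFiniteMeasure_of_isBounded hΩb
  obtain ⟨C, hC⟩ := exists_sobolev_eLpNorm (Ω := Ω) hN
  set V : ℝ≥0∞ := (volume.restrict Ω) univ ^
    (1 / (ENNReal.ofReal r).toReal - 1 / (ENNReal.ofReal (sobolevExp N)).toReal) with hV
  have hVtop : V ≠ ⊤ := by
    refine ENNReal.rpow_ne_top_of_nonneg ?_ (measure_ne_top _ _)
    rw [ENNReal.toReal_ofReal (hr.le.trans hrq), ENNReal.toReal_ofReal hr.le, sub_nonneg]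
    exact one_div_le_one_div_of_le hr hrq
  refine ⟨(C * V.toReal) ^ r, by positivity, fun v hv => ?_⟩
  have h := (eLpNorm_le_eLpNorm_mul_rpow_measure_univ (ENNReal.ofReal_le_ofReal hrq)
    (Lp.aestronglyMeasurable v.fst)).trans (mul_le_mul_left (hC v hv) V)
  rw [← ENNReal.ofReal_toReal hVtop, show (C : ℝ≥0∞) = ENNReal.ofReal C by simp,
    ← ENNReal.ofReal_mul C.coe_nonneg, ← ENNReal.ofReal_mul (by positivity)] at h
  have hmem : MemLp v.fst (ENNReal.ofReal r) (volume.restrict Ω) :=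
    ⟨Lp.aestronglyMeasurable _, h.trans_lt ENNReal.ofReal_lt_top⟩
  have hr0 : ENNReal.ofReal r ≠ 0 := by simpa using hr
  have hint := hmem.integrable_norm_rpow hr0 ENNReal.ofReal_ne_top
  have heq := hmem.eLpNorm_eq_integral_rpow_norm hr0 ENNReal.ofReal_ne_top
  rw [ENNReal.toReal_ofReal hr.le] at hint heq
  refine ⟨hint, ?_⟩
  have hI : 0 ≤ ∫ x in Ω, ‖v.fst x‖ ^ r := integral_nonneg fun x => by positivity
  rw [heq, ENNReal.ofReal_le_ofReal_iff (by positivity)] at h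
  have h2 := Real.rpow_le_rpow (by positivity) h hr.le
  rw [← Real.rpow_mul hI, inv_mul_cancel₀ hr.ne', Real.rpow_one, mul_right_comm,
    Real.mul_rpow (by positivity) (norm_nonneg _)] at h2
  exact h2

theorem exists_poincare (hN : 3 ≤ N) (hΩb : Bornology.IsBounded Ω) :
    ∃ C : ℝ, 0 ≤ C ∧ ∀ v ∈ H10 Ω, ‖v.fst‖ ≤ C * ‖v.snd‖ := by
  obtain ⟨C, hC0, hC⟩ := exists_sobolev hN hΩb two_pos (two_lt_sobolevExp hN).le
  refine ⟨Real.sqrt C, Real.sqrt_nonneg C, fun v hv => ?_⟩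
  have h := (hC v hv).2
  simp only [Real.rpow_two, sq_abs] at h
  have h2 : ∫ x in Ω, v.fst x ^ 2 = ‖v.fst‖ ^ 2 := by
    rw [← real_inner_self_eq_norm_sq, L2.inner_def]
    simp [sq]
  refine le_of_abs_le (abs_le_of_sq_le_sq ?_ (by positivity))
  rw [← h2, mul_pow, Real.sq_sqrt hC0]
  exact h

/-! ### Rellich's theorem -/

theorem eLpNorm_two_sq {α F : Type*} [MeasurableSpace α] {ν : Measure α} [NormedAddCommGroup F]
    (g : α → F) : eLpNorm g 2 ν ^ 2 = ∫⁻ x, ‖g x‖ₑ ^ 2 ∂ν := by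
  have h := eLpNorm_nnreal_pow_eq_lintegral (μ := ν) (f := g) (p := 2) (by norm_num)
  simpa using h

theorem enorm_integral_sq_le {α : Type*} [MeasurableSpace α] {ν : Measure α}
    [IsProbabilityMeasure ν] {g : α → ℝ} (hg : AEStronglyMeasurable g ν) :
    ‖∫ x, g x ∂ν‖ₑ ^ 2 ≤ ∫⁻ x, ‖g x‖ₑ ^ 2 ∂ν := by
  rw [← eLpNorm_two_sq]
  gcongr
  refine (enorm_integral_le_lintegral_enorm g).trans ?_
  rw [← eLpNorm_one_eq_lintegral_enorm]
  exact eLpNorm_le_eLpNorm_of_exponent_le one_le_two hg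

/-- Write the increment as the integral of the derivative along the segment from x to x + z, apply
Jensen, then Tonelli and translation invariance. -/
theorem lintegral_translate_sub_sq_le {φ : EuclideanSpace ℝ (Fin N) → ℝ} (hφ : ContDiff ℝ 1 φ)
    (z : EuclideanSpace ℝ (Fin N)) :
    ∫⁻ x, ‖φ x - φ (x + z)‖ₑ ^ 2 ≤ ‖z‖ₑ ^ 2 * ∫⁻ x, ‖fderiv ℝ φ x‖ₑ ^ 2 := by
  have hcd : Continuous (fderiv ℝ φ) := hφ.continuous_fderiv one_ne_zero
  have hpt : ∀ x, ‖φ x - φ (x + z)‖ₑ ^ 2 ≤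
      ∫⁻ s in Ioc (0 : ℝ) 1, ‖z‖ₑ ^ 2 * ‖fderiv ℝ φ (x + s • z)‖ₑ ^ 2 := by
    intro x
    have hc : Continuous fun s : ℝ => fderiv ℝ φ (x + s • z) z := by fun_prop
    have hder : ∀ s : ℝ, HasDerivAt (fun s : ℝ => φ (x + s • z)) (fderiv ℝ φ (x + s • z) z) s := by
      intro s
      have h1 : HasDerivAt (fun s : ℝ => x + s • z) z s := by
        simpa using ((hasDerivAt_id s).smul_const z).const_add x
      exact ((hφ.differentiable one_ne_zero) _).hasFDerivAt.comp_hasDerivAt s h1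
    have hftc := intervalIntegral.integral_eq_sub_of_hasDerivAt (a := 0) (b := 1)
      (fun s _ => hder s) (hc.intervalIntegrable _ _)
    rw [intervalIntegral.integral_of_le zero_le_one] at hftc
    simp only [one_smul, zero_smul, add_zero] at hftc
    have : IsProbabilityMeasure (volume.restrict (Ioc (0 : ℝ) 1)) := ⟨by simp⟩
    rw [← enorm_neg, neg_sub, ← hftc]
    refine (enorm_integral_sq_le hc.aestronglyMeasurable).trans (lintegral_mono fun s => ?_)
    rw [← mul_pow, mul_comm]
    gcongr
    exact ContinuousLinearMap.le_opENorm _ _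
  refine (lintegral_mono hpt).trans ?_
  rw [lintegral_lintegral_swap]
  · have : ∀ s : ℝ, ∫⁻ x, ‖z‖ₑ ^ 2 * ‖fderiv ℝ φ (x + s • z)‖ₑ ^ 2 =
        ‖z‖ₑ ^ 2 * ∫⁻ x, ‖fderiv ℝ φ x‖ₑ ^ 2 := by
      intro s
      rw [lintegral_add_right_eq_self (fun x => ‖z‖ₑ ^ 2 * ‖fderiv ℝ φ x‖ₑ ^ 2) (s • z),
        lintegral_const_mul _ (by fun_prop)]
    simp [this]
  · refine Measurable.aemeasurable ?_
    have h1 : Continuous fun q : EuclideanSpace ℝ (Fin N) × ℝ => fderiv ℝ φ (q.1 + q.2 • z) := by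
      fun_prop
    exact (h1.enorm.measurable.pow_const 2).const_mul _

/-- The mean over the ball `B(x, ε)` of the extension of `g` by zero outside `Ω`. -/
def ballMean (Ω : Set (EuclideanSpace ℝ (Fin N))) (ε : ℝ) (g : EuclideanSpace ℝ (Fin N) → ℝ)
    (x : EuclideanSpace ℝ (Fin N)) : ℝ :=
  (volume.real (Metric.ball (0 : EuclideanSpace ℝ (Fin N)) ε))⁻¹ *
    ∫ y in Metric.ball x ε, g y ∂(volume.restrict Ω)

theorem ballMean_congr {ε : ℝ} {g h : EuclideanSpace ℝ (Fin N) → ℝ}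
    (hgh : g =ᵐ[volume.restrict Ω] h) (x : EuclideanSpace ℝ (Fin N)) :
    ballMean Ω ε g x = ballMean Ω ε h x := by
  unfold ballMean
  rw [integral_congr_ae (ae_restrict_of_ae hgh)]

theorem stronglyMeasurable_ballMean (ε : ℝ) {g : EuclideanSpace ℝ (Fin N) → ℝ}
    (hg : StronglyMeasurable g) : StronglyMeasurable (ballMean Ω ε g) := by
  refine StronglyMeasurable.const_mul ?_ _
  have h : (fun x => ∫ y in Metric.ball x ε, g y ∂(volume.restrict Ω)) =
      fun x => ∫ y, {q : EuclideanSpace ℝ (Fin N) × EuclideanSpace ℝ (Fin N) |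
        dist q.2 q.1 < ε}.indicator (fun q => g q.2) (x, y) ∂(volume.restrict Ω) := by
    ext x
    rw [← integral_indicator Metric.isOpen_ball.measurableSet]
    rfl
  rw [h]
  refine StronglyMeasurable.integral_prod_right' (f :=
    {q : EuclideanSpace ℝ (Fin N) × EuclideanSpace ℝ (Fin N) |
        dist q.2 q.1 < ε}.indicator (fun q => g q.2)) ?_
  refine (hg.comp_measurable measurable_snd).indicator ?_
  exact (isOpen_lt (continuous_snd.dist continuous_fst) continuous_const).measurableSet

/-- A test function vanishes outside Ω, so the cutoff to Ω costs nothing and the mean is an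
expectation over the uniform law on the ball, ready for Jensen. -/
theorem ballMean_test {φ : EuclideanSpace ℝ (Fin N) → ℝ} (hφs : tsupport φ ⊆ Ω) {ε : ℝ}
    (x : EuclideanSpace ℝ (Fin N)) :
    ballMean Ω ε φ x =
      ∫ z, φ (x + z) ∂(ProbabilityTheory.cond volume (Metric.ball 0 ε)) := by
  have h1 : ∫ y in Metric.ball x ε, φ y ∂(volume.restrict Ω) = ∫ y in Metric.ball x ε, φ y := by
    rw [Measure.restrict_restrict Metric.isOpen_ball.measurableSet]
    refine setIntegral_eq_of_subset_of_forall_sdiff_eq_zero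
      Metric.isOpen_ball.measurableSet inter_subset_left (fun y hy => ?_) |>.symm
    by_contra h
    exact hy.2 ⟨hy.1, hφs (subset_tsupport φ h)⟩
  have h2 : ∫ y in Metric.ball x ε, φ y = ∫ z in Metric.ball 0 ε, φ (x + z) := by
    have h := (measurePreserving_add_left (volume : Measure (EuclideanSpace ℝ (Fin N))) x)
      |>.setIntegral_preimage_emb (measurableEmbedding_addLeft x) φ (Metric.ball x ε)
    rw [← h]
    congr 2
    ext z; simp
  unfold ballMean
  rw [h1, h2, ProbabilityTheory.cond, integral_smul_measure, smul_eq_mul, ENNReal.toReal_inv]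
  rfl

theorem eLpNorm_sub_ballMean_test_le {φ : EuclideanSpace ℝ (Fin N) → ℝ} (hφ : ContDiff ℝ 1 φ)
    (hφc : HasCompactSupport φ)
    (hφs : tsupport φ ⊆ Ω) {ε : ℝ} (hε : 0 < ε) :
    eLpNorm (fun x => φ x - ballMean Ω ε φ x) 2 (volume.restrict Ω) ≤
      ENNReal.ofReal ε * eLpNorm (fderiv ℝ φ) 2 volume := by
  set ν := ProbabilityTheory.cond (volume : Measure (EuclideanSpace ℝ (Fin N)))
    (Metric.ball 0 ε) with hν
  have : IsProbabilityMeasure ν :=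
    ProbabilityTheory.cond_isProbabilityMeasure_of_finite (Metric.measure_ball_pos _ _ hε).ne'
      measure_ball_lt_top.ne
  refine (eLpNorm_mono_measure _ Measure.restrict_le_self).trans ?_
  rw [← ENNReal.pow_le_pow_left_iff two_ne_zero, mul_pow, eLpNorm_two_sq, eLpNorm_two_sq]
  have hc : Continuous φ := hφ.continuous
  have hpt : ∀ x, ‖φ x - ballMean Ω ε φ x‖ₑ ^ 2 ≤ ∫⁻ z, ‖φ x - φ (x + z)‖ₑ ^ 2 ∂ν := by
    intro x
    have h1 : Integrable (fun z => φ (x + z)) ν := by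
      obtain ⟨C, hC⟩ := hφc.exists_bound_of_continuous hc
      exact Integrable.of_bound (by fun_prop) C (Eventually.of_forall fun z => hC _)
    have h2 : φ x - ballMean Ω ε φ x = ∫ z, (φ x - φ (x + z)) ∂ν := by
      rw [ballMean_test hφs, integral_sub (integrable_const _) h1, ← hν]; simp
    rw [h2]
    exact enorm_integral_sq_le (by fun_prop)
  refine (lintegral_mono hpt).trans ?_
  rw [lintegral_lintegral_swap]
  · have hball : ∀ᵐ z ∂ν, z ∈ Metric.ball (0 : EuclideanSpace ℝ (Fin N)) ε := by
      rw [hν, ProbabilityTheory.cond]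
      exact Measure.ae_smul_measure (ae_restrict_mem Metric.isOpen_ball.measurableSet) _
    calc ∫⁻ z, (∫⁻ x, ‖φ x - φ (x + z)‖ₑ ^ 2) ∂ν
        ≤ ∫⁻ _z, (ENNReal.ofReal ε ^ 2 * ∫⁻ x, ‖fderiv ℝ φ x‖ₑ ^ 2) ∂ν := by
          refine lintegral_mono_ae (hball.mono fun z hz => ?_)
          refine (lintegral_translate_sub_sq_le hφ z).trans ?_
          gcongr
          rw [← ofReal_norm]
          exact ENNReal.ofReal_le_ofReal (by simpa using (mem_ball_zero_iff.1 hz).le)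
      _ = _ := by simp
  · refine Measurable.aemeasurable ?_
    have h1 : Continuous fun q : EuclideanSpace ℝ (Fin N) × EuclideanSpace ℝ (Fin N) =>
      φ q.1 - φ (q.1 + q.2) := by fun_prop
    exact h1.enorm.measurable.pow_const 2

/-- The integral over a ball is the inner product with an indicator function. -/
theorem ballMean_eq_inner [IsFiniteMeasure (volume.restrict Ω)] (ε : ℝ)
    (g : Lp ℝ 2 (volume.restrict Ω)) (x : EuclideanSpace ℝ (Fin N)) :
    ballMean Ω ε g x = (volume.real (Metric.ball (0 : EuclideanSpace ℝ (Fin N)) ε))⁻¹ *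
      inner ℝ (indicatorConstLp 2 (Metric.isOpen_ball (x := x) (ε := ε)).measurableSet
        (measure_ne_top (volume.restrict Ω) _) (1 : ℝ)) g := by
  rw [L2.inner_indicatorConstLp_one]; rfl

theorem abs_ballMean_le [IsFiniteMeasure (volume.restrict Ω)] (ε : ℝ)
    (g : Lp ℝ 2 (volume.restrict Ω)) (x : EuclideanSpace ℝ (Fin N)) :
    |ballMean Ω ε g x| ≤ (volume.real (Metric.ball (0 : EuclideanSpace ℝ (Fin N)) ε))⁻¹ *
      ((volume.restrict Ω).real univ ^ (1 / 2 : ℝ) * ‖g‖) := by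
  rw [ballMean_eq_inner, abs_mul, abs_of_nonneg (a := (_ : ℝ)⁻¹) (by positivity)]
  gcongr
  refine (abs_real_inner_le_norm _ _).trans ?_
  gcongr
  rw [norm_indicatorConstLp two_ne_zero ENNReal.ofNat_ne_top]
  simp only [norm_one, one_mul, ENNReal.toReal_ofNat]
  exact Real.rpow_le_rpow measureReal_nonneg (measureReal_mono (subset_univ _)) (by norm_num)

/-- For test functions, average the translation estimate over |z| < ε. In the closure, ball means
converge at every point, being inner products with a fixed indicator, so Fatou applies again. -/
theorem eLpNorm_sub_ballMean_le [IsFiniteMeasure (volume.restrict Ω)] {v : L2Pair Ω}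
    (hv : v ∈ H10 Ω) {ε : ℝ} (hε : 0 < ε) :
    eLpNorm (fun x => v.fst x - ballMean Ω ε v.fst x) 2 (volume.restrict Ω) ≤
      ENNReal.ofReal ε * ENNReal.ofReal ‖v.snd‖ := by
  have htest : ∀ v ∈ testPairs Ω,
      eLpNorm (fun x => v.fst x - ballMean Ω ε v.fst x) 2 (volume.restrict Ω) ≤
      ENNReal.ofReal ε * ENNReal.ofReal ‖v.snd‖ := by
    rintro v ⟨φ, hφ, hφc, hφs, h1, h2⟩
    rw [← eLpNorm_snd, eLpNorm_congr_ae h2,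
      eLpNorm_restrict_eq_of_support_subset ((support_gradient_subset φ).trans hφs),
      eLpNorm_congr_norm_ae (Eventually.of_forall (norm_gradient φ))]
    refine le_of_eq_of_le (eLpNorm_congr_ae ?_)
      (eLpNorm_sub_ballMean_test_le (hφ.of_le (by simp)) hφc hφs hε)
    filter_upwards [h1] with x hx
    rw [hx, ballMean_congr h1]
  obtain ⟨w, hw, hwv⟩ := exists_testPairs_tendsto hv
  have hw1 := (L2Pair.continuous_fst.tendsto v).comp hwv
  obtain ⟨ns, hns, hae⟩ := exists_ae_tendsto_of_tendsto hw1
  have hae' : ∀ᵐ x ∂(volume.restrict Ω), Tendsto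
      (fun n => (w (ns n)).fst x - ballMean Ω ε (w (ns n)).fst x) atTop
      (𝓝 (v.fst x - ballMean Ω ε v.fst x)) := by
    filter_upwards [hae] with x hx
    refine hx.sub ?_
    simp only [ballMean_eq_inner]
    exact (tendsto_const_nhds.inner (hw1.comp hns.tendsto_atTop)).const_mul _
  refine (Lp.eLpNorm_lim_le_liminf_eLpNorm
    (fun n => (Lp.aestronglyMeasurable (w (ns n)).fst).sub
      (stronglyMeasurable_ballMean ε (Lp.stronglyMeasurable _)).aestronglyMeasurable) _ hae').trans ?_
  have hlim : Tendsto (fun n => ENNReal.ofReal ε * ENNReal.ofReal ‖(w (ns n)).snd‖) atTop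
      (𝓝 (ENNReal.ofReal ε * ENNReal.ofReal ‖v.snd‖)) := by
    refine ENNReal.Tendsto.const_mul ?_ (Or.inr ENNReal.ofReal_ne_top)
    exact ENNReal.tendsto_ofReal
      (((continuous_norm.comp L2Pair.continuous_snd).tendsto v).comp (hwv.comp hns.tendsto_atTop))
  rw [← hlim.liminf_eq]
  exact liminf_le_liminf (Eventually.of_forall fun n => htest _ (hw _))

/-- At fixed ε the ball means are uniformly bounded and tend to 0 pointwise by weak convergence,
hence in L². The remainder u - mean is at most εM in L², uniformly in n. -/
theorem tendsto_fst_of_weakly_null [IsFiniteMeasure (volume.restrict Ω)] {u : ℕ → L2Pair Ω}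
    (hu : ∀ n, u n ∈ H10 Ω) {M : ℝ} (hM : ∀ n, ‖u n‖ ≤ M)
    (hweak : ∀ g, Tendsto (fun n => inner ℝ g (u n).fst) atTop (𝓝 0)) :
    Tendsto (fun n => ‖(u n).fst‖) atTop (𝓝 0) := by
  have hM1 : ∀ n, ‖(u n).fst‖ ≤ M := fun n => (WithLp.norm_fst_le _ _).trans (hM n)
  have hM2 : ∀ n, ‖(u n).snd‖ ≤ M := fun n => (WithLp.norm_snd_le _ _).trans (hM n)
  have hM0 : 0 ≤ M := (norm_nonneg _).trans (hM 0)
  have hmean : ∀ ε > 0, Tendsto (fun n => eLpNorm (ballMean Ω ε (u n).fst) 2 (volume.restrict Ω))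
      atTop (𝓝 0) := by
    intro ε hε
    set B := (volume.real (Metric.ball (0 : EuclideanSpace ℝ (Fin N)) ε))⁻¹ *
      ((volume.restrict Ω).real univ ^ (1 / 2 : ℝ) * M)
    have h : Tendsto (fun n => ∫⁻ x in Ω, ‖ballMean Ω ε (u n).fst x‖ₑ ^ 2) atTop
        (𝓝 (∫⁻ _x in Ω, 0)) := by
      refine tendsto_lintegral_of_dominated_convergence (fun _ => ENNReal.ofReal B ^ 2)
        (fun n => (stronglyMeasurable_ballMean ε (Lp.stronglyMeasurable _)).enorm.pow_const 2)
        (fun n => Eventually.of_forall fun x => ?_) ?_ (Eventually.of_forall fun x => ?_)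
      · refine pow_le_pow_left' ?_ 2
        rw [Real.enorm_eq_ofReal_abs]
        refine ENNReal.ofReal_le_ofReal ((abs_ballMean_le ε _ x).trans ?_)
        exact mul_le_mul_of_nonneg_left
          (mul_le_mul_of_nonneg_left (hM1 n) (by positivity)) (by positivity)
      · rw [lintegral_const]
        exact ENNReal.mul_ne_top (by finiteness) (measure_ne_top _ _)
      · have h1 : Tendsto (fun n => ballMean Ω ε (u n).fst x) atTop (𝓝 0) := by
          simp only [ballMean_eq_inner]
          simpa using (hweak _).const_mul _
        have h2 := ENNReal.Tendsto.pow (n := 2) h1.enorm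
        simpa using h2
    simp only [lintegral_zero, ← eLpNorm_two_sq] at h
    have h3 := h.ennrpow_const (1 / 2 : ℝ)
    rw [ENNReal.zero_rpow_of_pos (by norm_num)] at h3
    refine h3.congr fun n => ?_
    rw [← ENNReal.rpow_two, ← ENNReal.rpow_mul]
    norm_num
  have hmain : Tendsto (fun n => ENNReal.ofReal ‖(u n).fst‖) atTop (𝓝 0) := by
    rw [ENNReal.tendsto_nhds_zero]
    intro δ hδ
    rcases eq_or_ne δ ⊤ with rfl | hδt
    · simp
    lift δ to ℝ≥0 using hδt
    have hδ0 : (0 : ℝ) < δ := by exact_mod_cast hδ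
    -- This leaves δ/2 for each of the two terms; M + 1 keeps the denominator positive when M = 0.
    set ε : ℝ := δ / (2 * (M + 1)) with hε
    have hε0 : 0 < ε := by positivity
    have hev := ENNReal.tendsto_nhds_zero.1 (hmean ε hε0) (ENNReal.ofReal (δ / 2))
      (by simpa using hδ0)
    filter_upwards [hev] with n hn
    have hsplit : eLpNorm (u n).fst 2 (volume.restrict Ω) ≤
        eLpNorm (fun x => (u n).fst x - ballMean Ω ε (u n).fst x) 2 (volume.restrict Ω) +
        eLpNorm (ballMean Ω ε (u n).fst) 2 (volume.restrict Ω) := by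
      have hm := (stronglyMeasurable_ballMean (Ω := Ω) ε
        (Lp.stronglyMeasurable (u n).fst)).aestronglyMeasurable (μ := volume.restrict Ω)
      have h := eLpNorm_add_le ((Lp.aestronglyMeasurable (u n).fst).sub hm) hm one_le_two
      rwa [sub_add_cancel] at h
    rw [← eLpNorm_fst]
    refine hsplit.trans ((add_le_add (eLpNorm_sub_ballMean_le (hu n) hε0) hn).trans ?_)
    rw [← ENNReal.ofReal_mul hε0.le, ← ENNReal.ofReal_add (by positivity) (by positivity),
      ← ENNReal.ofReal_coe_nnreal]
    refine ENNReal.ofReal_le_ofReal ?_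
    have : ε * ‖(u n).snd‖ ≤ δ / 2 := by
      rw [hε, div_mul_eq_mul_div, div_le_div_iff₀ (by positivity) two_pos]
      nlinarith [hM2 n]
    linarith
  have h4 := (ENNReal.tendsto_toReal ENNReal.zero_ne_top).comp hmain
  refine h4.congr fun n => ?_
  simp

/-- Bounded sequences of a separable Hilbert space have weakly convergent subsequences. -/
theorem exists_subseq_weakly_tendsto {H : Type*} [NormedAddCommGroup H] [InnerProductSpace ℝ H]
    [CompleteSpace H] [TopologicalSpace.SeparableSpace H] {v : ℕ → H} {M : ℝ}
    (hM : ∀ n, ‖v n‖ ≤ M) :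
    ∃ u : H, ∃ ns : ℕ → ℕ, StrictMono ns ∧
      ∀ g, Tendsto (fun n => inner ℝ (v (ns n)) g) atTop (𝓝 (inner ℝ u g)) := by
  obtain ⟨l, -, ns, hns, hl⟩ := WeakDual.isSeqCompact_closedBall ℝ H 0 M
    (x := fun n => StrongDual.toWeakDual (InnerProductSpace.toDual ℝ H (v n)))
    (fun n => by simpa using hM n)
  refine ⟨(InnerProductSpace.toDual ℝ H).symm (WeakDual.toStrongDual l), ns, hns, fun g => ?_⟩
  have h := ((WeakDual.eval_continuous g).tendsto l).comp hl
  rw [InnerProductSpace.toDual_symm_apply]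
  exact h

theorem exists_subseq_tendsto (hN : 3 ≤ N) (hΩb : Bornology.IsBounded Ω) {v : ℕ → L2Pair Ω}
    (hv : ∀ n, v n ∈ H10 Ω) {M : ℝ} (hM : ∀ n, ‖(v n).snd‖ ≤ M) :
    ∃ u ∈ H10 Ω, ∃ ns : ℕ → ℕ, StrictMono ns ∧
      (∀ g, Tendsto (fun n => inner ℝ (v (ns n)).snd g) atTop (𝓝 (inner ℝ u.snd g))) ∧
      ∀ᵐ x ∂(volume.restrict Ω), Tendsto (fun n => (v (ns n)).fst x) atTop (𝓝 (u.fst x)) := by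
  have := isFiniteMeasure_of_isBounded hΩb
  obtain ⟨C, hC0, hC⟩ := exists_poincare hN hΩb
  have hbd : ∀ n, ‖v n‖ ≤ C * M + M := by
    intro n
    have h1 : ‖(v n).fst‖ ≤ C * M := (hC _ (hv n)).trans (by gcongr; exact hM n)
    have h2 := hM n
    have h3 := WithLp.prod_norm_sq_eq_of_L2 (v n)
    have h4 : 0 ≤ C * M := (norm_nonneg _).trans h1
    have h5 : 0 ≤ M := (norm_nonneg _).trans h2
    refine le_of_abs_le (abs_le_of_sq_le_sq ?_ (by positivity))
    nlinarith [norm_nonneg (v n).fst, norm_nonneg (v n).snd]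
  have h0 : Fact ((2 : ℝ≥0∞) ≠ ⊤) := ⟨ENNReal.ofNat_ne_top⟩
  have h1 : SecondCountableTopology (Lp ℝ 2 (volume.restrict Ω)) := inferInstance
  have h2 : SecondCountableTopology (Lp (EuclideanSpace ℝ (Fin N)) 2 (volume.restrict Ω)) :=
    inferInstance
  have h3 : SecondCountableTopology (L2Pair Ω) := WithLp.secondCountableTopology 2 _ _
  obtain ⟨u, ns, hns, hu⟩ := exists_subseq_weakly_tendsto hbd
  have huH : u ∈ H10 Ω := by
    have hcl : IsClosed (H10 Ω : Set (L2Pair Ω)) := Submodule.isClosed_topologicalClosure _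
    have : CompleteSpace (H10 Ω) := hcl.completeSpace_coe
    -- A closed subspace is its own double orthogonal complement, so membership can be tested by
    -- inner products and survives weak limits.
    rw [← Submodule.orthogonal_orthogonal (H10 Ω), Submodule.mem_orthogonal']
    intro g hg
    refine tendsto_nhds_unique (hu g) (tendsto_const_nhds.congr fun n => ?_)
    exact (Submodule.inner_right_of_mem_orthogonal (hv _) hg).symm
  have hfst : Tendsto (fun n => ‖(v (ns n) - u).fst‖) atTop (𝓝 0) := by
    refine tendsto_fst_of_weakly_null (M := C * M + M + ‖u‖)
      (fun n => (H10 Ω).sub_mem (hv _) huH)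
      (fun n => (norm_sub_le _ _).trans (by gcongr; exact hbd _)) fun g => ?_
    have h := (hu (WithLp.toLp 2 (g, 0))).sub_const (inner ℝ u (WithLp.toLp 2 (g, 0)))
    rw [sub_self] at h
    refine h.congr fun n => ?_
    rw [← inner_sub_left, WithLp.prod_inner_apply, real_inner_comm]
    simp
  have hfst' : Tendsto (fun n => (v (ns n)).fst) atTop (𝓝 u.fst) :=
    tendsto_iff_norm_sub_tendsto_zero.2 hfst
  obtain ⟨ms, hms, hae⟩ := exists_ae_tendsto_of_tendsto (w := fun n => v (ns n)) hfst'
  refine ⟨u, huH, fun n => ns (ms n), hns.comp hms, fun g => ?_, hae⟩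
  have h := (hu (WithLp.toLp 2 (0, g))).comp hms.tendsto_atTop
  simpa [WithLp.prod_inner_apply, Function.comp_def] using h

/-! ### Elementary inequalities between powers -/

theorem rpow_le_one_add_rpow {y p P : ℝ} (hy : 0 ≤ y) (hp : 0 ≤ p) (hpP : p ≤ P) :
    y ^ p ≤ 1 + y ^ P := by
  rcases le_total y 1 with h | h
  · have := Real.rpow_le_one hy h hp
    have := Real.rpow_nonneg hy P
    linarith
  · have := Real.rpow_le_rpow_of_exponent_le h hpP
    linarith

/-- Weighted AM–GM for y^P and 1 with weights p/P and 1 - p/P; equality holds at y = 1. -/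
theorem rpow_div_sub_le {y p P : ℝ} (hy : 0 ≤ y) (hp : 0 < p) (hpP : p ≤ P) :
    1 / p * y ^ p - 1 / P * y ^ P ≤ 1 / p - 1 / P := by
  have hP : 0 < P := hp.trans_le hpP
  have h := Real.geom_mean_le_arith_mean2_weighted (w₁ := p / P) (w₂ := 1 - p / P)
    (p₁ := y ^ P) (p₂ := 1) (by positivity) (by rw [sub_nonneg, div_le_one hP]; exact hpP)
    (by positivity) zero_le_one (by ring)
  rw [← Real.rpow_mul hy, Real.one_rpow, mul_one, mul_one, mul_div_cancel₀ _ hP.ne'] at h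
  have h2 := mul_le_mul_of_nonneg_left h (one_div_pos.2 hp).le
  have h3 : 1 / p * (p / P * y ^ P + (1 - p / P)) = 1 / P * y ^ P + (1 / p - 1 / P) := by
    field_simp
  linarith

/-- The function y^P/P - y^p/p is nonpositive on [0, 1] and nondecreasing on [1, ∞). It replaces an
unknown scaling t ≤ 2, which varies with p, by the fixed scaling 2. -/
theorem rpow_div_sub_le_abs {y h p P : ℝ} (hy : 0 ≤ y) (hyh : y ≤ h) (hp : 0 < p)
    (hpP : p ≤ P) :
    1 / P * y ^ P - 1 / p * y ^ p ≤ |1 / P * h ^ P - 1 / p * h ^ p| := by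
  have hP : 0 < P := hp.trans_le hpP
  rcases le_total y 1 with h1 | h1
  · refine le_trans ?_ (abs_nonneg _)
    rcases hy.eq_or_lt with rfl | hy
    · rw [Real.zero_rpow hP.ne', Real.zero_rpow hp.ne']; simp
    have h2 : y ^ P ≤ y ^ p := Real.rpow_le_rpow_of_exponent_ge hy h1 hpP
    have h3 : 1 / P ≤ 1 / p := one_div_le_one_div_of_le hp hpP
    have h4 : 0 ≤ y ^ P := by positivity
    have h5 : 0 ≤ 1 / p := by positivity
    nlinarith
  · refine le_trans ?_ (le_abs_self _)
    have hy0 : 0 < y := by linarith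
    -- Monotonicity without calculus: (c^P - 1)/P · y^P ≥ (c^P - 1)/P · y^p ≥ (c^p - 1)/p · y^p, the
    -- last by `rpow_div_sub_le` at c.
    obtain ⟨c, hc, rfl⟩ : ∃ c, 1 ≤ c ∧ h = c * y :=
      ⟨h / y, (one_le_div hy0).2 hyh, by field_simp⟩
    have hc0 : 0 ≤ c := by linarith
    rw [Real.mul_rpow hc0 hy, Real.mul_rpow hc0 hy]
    have h2 := rpow_div_sub_le hc0 hp hpP
    have h3 : y ^ p ≤ y ^ P := Real.rpow_le_rpow_of_exponent_le h1 hpP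
    have h4 : 0 ≤ y ^ p := by positivity
    have h5 : 0 ≤ 1 / P * c ^ P - 1 / P := by
      have := Real.one_le_rpow hc hP.le
      have h6 : 0 < 1 / P := by positivity
      nlinarith
    nlinarith [mul_le_mul_of_nonneg_right h3 h5]

theorem exists_const_add_rpow {c r q ε : ℝ} (hc : 0 ≤ c) (hr : 0 ≤ r) (hrq : r < q) (hε : 0 < ε) :
    ∃ C : ℝ, 0 ≤ C ∧ ∀ y : ℝ, 0 ≤ y → c * y ^ r ≤ C + ε * y ^ q := by
  have h1 : Tendsto (fun M : ℝ => c * M ^ (-(q - r))) atTop (𝓝 (c * 0)) :=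
    (tendsto_rpow_neg_atTop (sub_pos.2 hrq)).const_mul c
  rw [mul_zero] at h1
  obtain ⟨M, hM, hM0⟩ := ((h1.eventually_lt_const hε).and (eventually_gt_atTop 0)).exists
  refine ⟨c * M ^ r, by positivity, fun y hy => ?_⟩
  rcases le_total y M with h | h
  · have h2 : y ^ r ≤ M ^ r := Real.rpow_le_rpow hy h hr
    have h3 : 0 ≤ ε * y ^ q := by positivity
    nlinarith
  · have hy0 : 0 < y := hM0.trans_le h
    have h2 : y ^ (-(q - r)) ≤ M ^ (-(q - r)) :=
      Real.rpow_le_rpow_of_nonpos hM0 h (by linarith)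
    have h3 : y ^ r = y ^ (-(q - r)) * y ^ q := by
      rw [← Real.rpow_add hy0]; congr 1; ring
    have h4 : 0 ≤ y ^ q := by positivity
    have h5 : 0 ≤ c * M ^ r := by positivity
    rw [h3]
    have : c * (y ^ (-(q - r)) * y ^ q) ≤ ε * y ^ q := by
      rw [← mul_assoc]
      gcongr
      nlinarith
    linarith

/-- Continuity of a subcritical integral functional along sequences that converge almost everywhere
and are bounded in `L^q`. -/
theorem tendsto_integral_of_subcritical {α : Type*} [MeasurableSpace α] {ν : Measure α}
    [IsFiniteMeasure ν] {w : ℕ → α → ℝ} {u : α → ℝ} {G : ℝ → ℝ} (hG : Continuous G)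
    {c r q L : ℝ} (hc : 0 ≤ c) (hr : 0 ≤ r) (hrq : r < q) (hGb : ∀ s, |G s| ≤ c * |s| ^ r)
    (hw : ∀ n, AEStronglyMeasurable (w n) ν) (hu : AEStronglyMeasurable u ν)
    (hwi : ∀ n, Integrable (fun x => |w n x| ^ q) ν) (hui : Integrable (fun x => |u x| ^ q) ν)
    (hL : ∀ n, ∫ x, |w n x| ^ q ∂ν ≤ L)
    (hlim : ∀ᵐ x ∂ν, Tendsto (fun n => w n x) atTop (𝓝 (u x))) :
    Tendsto (fun n => ∫ x, G (w n x) ∂ν) atTop (𝓝 (∫ x, G (u x) ∂ν)) := by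
  have hq : 0 ≤ q := hr.trans hrq.le
  have hL0 : 0 ≤ L := (integral_nonneg fun x => by positivity).trans (hL 0)
  have hint : ∀ g : α → ℝ, AEStronglyMeasurable g ν → Integrable (fun x => |g x| ^ q) ν →
      Integrable (fun x => G (g x)) ν := by
    intro g hg hgi
    obtain ⟨C, -, hC⟩ := exists_const_add_rpow hc hr hrq one_pos
    refine ((integrable_const C).add (hgi.const_mul 1)).mono'
      (hG.comp_aestronglyMeasurable hg) (Eventually.of_forall fun x => ?_)
    exact (hGb _).trans (hC _ (abs_nonneg _))
  have hGw := fun n => hint _ (hw n) (hwi n)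
  have hGu := hint _ hu hui
  rw [Metric.tendsto_atTop']
  intro ε hε
  set η : ℝ := ε / (2 * (L + 1)) with hη
  have hη0 : 0 < η := by positivity
  obtain ⟨C, hC0, hC⟩ := exists_const_add_rpow hc hr hrq hη0
  -- Subtracting η|w_n|^q absorbs the growth of G(w_n), so the positive part is dominated by C +
  -- |G(u)|. What was subtracted costs at most ηL in the integral.
  have hdom : Tendsto (fun n => ∫ x, max (|G (w n x) - G (u x)| - η * |w n x| ^ q) 0 ∂ν) atTop
      (𝓝 (∫ _x, (0 : ℝ) ∂ν)) := by
    refine tendsto_integral_of_dominated_convergence (fun x => C + |G (u x)|)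
      (fun n => ?_) ((integrable_const C).add hGu.abs) (fun n => Eventually.of_forall fun x => ?_)
      ?_
    · exact ((((hGw n).sub hGu).abs.sub ((hwi n).const_mul η)).aestronglyMeasurable).sup
        aestronglyMeasurable_const
    · rw [Real.norm_eq_abs, abs_of_nonneg (le_max_right _ _)]
      refine max_le ?_ (by positivity)
      have h1 := abs_sub (G (w n x)) (G (u x))
      have h2 := (hGb (w n x)).trans (hC _ (abs_nonneg _))
      linarith
    · filter_upwards [hlim] with x hx
      have h1 : Tendsto (fun n => |G (w n x) - G (u x)| - η * |w n x| ^ q) atTop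
          (𝓝 (|G (u x) - G (u x)| - η * |u x| ^ q)) := by
        refine ((((hG.tendsto _).comp hx).sub_const _).abs).sub (Tendsto.const_mul _ ?_)
        exact hx.abs.rpow_const (Or.inr hq)
      have h2 := h1.max (tendsto_const_nhds (x := (0 : ℝ)))
      rwa [sub_self, abs_zero, zero_sub, max_eq_right] at h2
      have : 0 ≤ η * |u x| ^ q := by positivity
      linarith
  rw [integral_zero] at hdom
  obtain ⟨n₀, hn₀⟩ := (hdom.eventually_lt_const (half_pos hε)).exists_forall_of_atTop
  refine ⟨n₀, fun n hn => ?_⟩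
  rw [Real.dist_eq, ← integral_sub (hGw n) hGu]
  have hmi : Integrable (fun x => max (|G (w n x) - G (u x)| - η * |w n x| ^ q) 0) ν :=
    (((hGw n).sub hGu).abs.sub ((hwi n).const_mul η)).sup (integrable_zero _ _ _)
  calc |∫ x, (G (w n x) - G (u x)) ∂ν| ≤ ∫ x, |G (w n x) - G (u x)| ∂ν :=
        abs_integral_le_integral_abs
    _ ≤ ∫ x, (max (|G (w n x) - G (u x)| - η * |w n x| ^ q) 0 + η * |w n x| ^ q) ∂ν := by
        refine integral_mono ((hGw n).sub hGu).abs (hmi.add ((hwi n).const_mul η)) fun x => ?_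
        have := le_max_left (|G (w n x) - G (u x)| - η * |w n x| ^ q) 0
        dsimp only
        linarith
    _ = ∫ x, max (|G (w n x) - G (u x)| - η * |w n x| ^ q) 0 ∂ν + η * ∫ x, |w n x| ^ q ∂ν := by
        rw [integral_add hmi ((hwi n).const_mul η), integral_const_mul]
    _ < ε / 2 + η * (L + 1) := by
        have h1 := hn₀ n hn.le
        have h2 := hL n
        have h3 : η * ∫ x, |w n x| ^ q ∂ν ≤ η * (L + 1) := by gcongr; linarith
        linarith
    _ = ε := by rw [hη]; field_simp; ring

/-! ### The functionals on rays -/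

theorem fst_smul_ae (t : ℝ) (v : L2Pair Ω) :
    ∀ᵐ x ∂(volume.restrict Ω), (t • v).fst x = t * v.fst x := by
  filter_upwards [Lp.coeFn_smul t v.fst] with x hx
  rw [WithLp.smul_fst, hx]; rfl

theorem energyDeriv_self (p : ℝ) (v : L2Pair Ω) :
    energyDeriv Ω p v v = ‖v.snd‖ ^ 2 - ∫ x in Ω, nehariDensity p (v.fst x) := by
  rw [← integral_inner_snd_self]; rfl

theorem mem_nehari_iff {p : ℝ} {v : L2Pair Ω} : v ∈ nehari Ω p ↔
    v ∈ H10 Ω ∧ v.fst ≠ 0 ∧ ∫ x in Ω, nehariDensity p (v.fst x) = ‖v.snd‖ ^ 2 := by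
  rw [nehari, mem_ofPred_eq, energyDeriv_self, sub_eq_zero, eq_comm (a := ‖v.snd‖ ^ 2)]

theorem energy_eq (p : ℝ) (v : L2Pair Ω) :
    energy Ω p v = 1 / 2 * ‖v.snd‖ ^ 2 - 1 / p * ∫ x in Ω, |change (v.fst x)| ^ p := by
  rw [energy, integral_norm_snd_sq]

theorem norm_snd_smul_sq (t : ℝ) (v : L2Pair Ω) : ‖(t • v).snd‖ ^ 2 = t ^ 2 * ‖v.snd‖ ^ 2 := by
  rw [WithLp.smul_snd, norm_smul, mul_pow, Real.norm_eq_abs, sq_abs]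

theorem energy_smul (p t : ℝ) (v : L2Pair Ω) :
    energy Ω p (t • v) =
      1 / 2 * (t ^ 2 * ‖v.snd‖ ^ 2) - 1 / p * ∫ x in Ω, |change (t * v.fst x)| ^ p := by
  rw [energy_eq, norm_snd_smul_sq]
  congr 2
  refine integral_congr_ae ?_
  filter_upwards [fst_smul_ae t v] with x hx
  rw [hx]

theorem smul_mem_nehari_iff {p t : ℝ} (ht : t ≠ 0) {v : L2Pair Ω} (hv : v ∈ H10 Ω)
    (hv0 : v.fst ≠ 0) : t • v ∈ nehari Ω p ↔
      ∫ x in Ω, nehariDensity p (t * v.fst x) = t ^ 2 * ‖v.snd‖ ^ 2 := by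
  have h : ∫ x in Ω, nehariDensity p ((t • v).fst x) =
      ∫ x in Ω, nehariDensity p (t * v.fst x) := by
    refine integral_congr_ae ?_
    filter_upwards [fst_smul_ae t v] with x hx
    rw [hx]
  rw [mem_nehari_iff, h, norm_snd_smul_sq]
  refine ⟨fun h => h.2.2, fun h => ⟨(H10 Ω).smul_mem t hv, ?_, h⟩⟩
  rw [WithLp.smul_fst]
  exact smul_ne_zero ht hv0

theorem integrable_abs_change_rpow (hN : 3 ≤ N) (hΩb : Bornology.IsBounded Ω) {p : ℝ}
    (hp : 0 ≤ p) (hpP : p ≤ 2 * sobolevExp N) (t : ℝ) {v : L2Pair Ω} (hv : v ∈ H10 Ω) :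
    Integrable (fun x => |change (t * v.fst x)| ^ p) (volume.restrict Ω) := by
  have := isFiniteMeasure_of_isBounded hΩb
  have hq := two_lt_sobolevExp hN
  obtain ⟨C, -, hC⟩ := exists_sobolev hN hΩb (by linarith) (le_refl (sobolevExp N))
  refine ((integrable_const 1).add (((hC v hv).1.const_mul (|t| ^ sobolevExp N)).const_mul
    (Real.sqrt 2 ^ sobolevExp N))).mono' ?_ (Eventually.of_forall fun x => ?_)
  · exact (continuous_abs_change_rpow hp).comp_aestronglyMeasurable
      ((Lp.aestronglyMeasurable _).const_mul t)
  · rw [Real.norm_eq_abs, abs_of_nonneg (by positivity)]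
    refine (rpow_le_one_add_rpow (abs_nonneg _) hp hpP).trans ?_
    have h := abs_change_rpow_le (p := 2 * sobolevExp N) (by linarith) (t * v.fst x)
    rw [mul_div_cancel_left₀ _ two_ne_zero, abs_mul,
      Real.mul_rpow (abs_nonneg _) (abs_nonneg _)] at h
    simpa using h

theorem integrable_nehariDensity (hN : 3 ≤ N) (hΩb : Bornology.IsBounded Ω) {p : ℝ}
    (hp : 2 ≤ p) (hpP : p ≤ 2 * sobolevExp N) (t : ℝ) {v : L2Pair Ω} (hv : v ∈ H10 Ω) :
    Integrable (fun x => nehariDensity p (t * v.fst x)) (volume.restrict Ω) := by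
  refine (integrable_abs_change_rpow hN hΩb (by linarith) hpP t hv).mono' ?_
    (Eventually.of_forall fun x => ?_)
  · exact (continuous_nehariDensity hp).comp_aestronglyMeasurable
      ((Lp.aestronglyMeasurable _).const_mul t)
  · rw [Real.norm_eq_abs, abs_of_nonneg (nehariDensity_nonneg _ _)]
    exact nehariDensity_le hp _

theorem norm_snd_pos (hN : 3 ≤ N) (hΩb : Bornology.IsBounded Ω) {v : L2Pair Ω} (hv : v ∈ H10 Ω)
    (hv0 : v.fst ≠ 0) : 0 < ‖v.snd‖ := by
  obtain ⟨C, hC0, hC⟩ := exists_poincare hN hΩb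
  have h1 := norm_pos_iff.2 hv0
  by_contra h
  have h2 : ‖v.snd‖ = 0 := le_antisymm (not_lt.1 h) (norm_nonneg _)
  have := hC v hv
  rw [h2] at this
  linarith

theorem integral_nehariDensity_pos (hN : 3 ≤ N) (hΩb : Bornology.IsBounded Ω) {p : ℝ}
    (hp : 2 ≤ p) (hpP : p ≤ 2 * sobolevExp N) {v : L2Pair Ω} (hv : v ∈ H10 Ω)
    (hv0 : v.fst ≠ 0) : 0 < ∫ x in Ω, nehariDensity p (v.fst x) := by
  have hi := integrable_nehariDensity hN hΩb hp hpP 1 hv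
  simp only [one_mul] at hi
  have h0 : 0 ≤ ∫ x in Ω, nehariDensity p (v.fst x) :=
    integral_nonneg fun x => nehariDensity_nonneg _ _
  refine lt_of_le_of_ne h0 fun h => hv0 ?_
  have h2 := (integral_eq_zero_iff_of_nonneg (fun x => nehariDensity_nonneg _ _) hi).1 h.symm
  refine Lp.eq_zero_iff_ae_eq_zero.2 ?_
  filter_upwards [h2] with x hx
  by_contra hne
  exact (nehariDensity_pos (p := p) hne).ne' hx

/-- Integrate `fiber_le`; the Nehari identity turns its right side into (1 - t²)/2 · ‖∇v‖², exactly
the change in the Dirichlet term. -/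
theorem energy_smul_le (hN : 3 ≤ N) (hΩb : Bornology.IsBounded Ω) {p : ℝ} (hp : 4 ≤ p)
    (hpP : p ≤ 2 * sobolevExp N) {v : L2Pair Ω} (hv : v ∈ nehari Ω p) {t : ℝ} (ht : 0 ≤ t) :
    energy Ω p (t • v) ≤ energy Ω p v := by
  obtain ⟨hvH, -, hvK⟩ := mem_nehari_iff.1 hv
  have i1 := integrable_abs_change_rpow hN hΩb (by linarith) hpP 1 hvH
  have i2 := integrable_abs_change_rpow hN hΩb (by linarith) hpP t hvH
  have i3 := integrable_nehariDensity hN hΩb (by linarith) hpP 1 hvH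
  simp only [one_mul] at i1 i3
  have h := integral_mono ((i1.const_mul (1 / p)).sub (i2.const_mul (1 / p)))
    (i3.const_mul ((1 - t ^ 2) / 2)) fun x => fiber_le hp (v.fst x) ht
  simp only [Pi.sub_apply] at h
  rw [integral_sub (i1.const_mul _) (i2.const_mul _), integral_const_mul, integral_const_mul,
    integral_const_mul, hvK] at h
  rw [energy_smul, energy_eq]
  linarith

theorem mul_norm_sq_le_energy (hN : 3 ≤ N) (hΩb : Bornology.IsBounded Ω) {p : ℝ} (hp : 4 ≤ p)
    (hpP : p ≤ 2 * sobolevExp N) {v : L2Pair Ω} (hv : v ∈ nehari Ω p) :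
    (1 / 2 - 2 / p) * ‖v.snd‖ ^ 2 ≤ energy Ω p v := by
  obtain ⟨hvH, -, hvK⟩ := mem_nehari_iff.1 hv
  have i1 := integrable_abs_change_rpow hN hΩb (by linarith) hpP 1 hvH
  have i3 := integrable_nehariDensity hN hΩb (by linarith) hpP 1 hvH
  simp only [one_mul] at i1 i3
  have h := integral_mono i1 (i3.const_mul 2) fun x =>
    le_two_mul_nehariDensity (by linarith) (v.fst x)
  rw [integral_const_mul, hvK] at h
  have hp0 : 0 < 1 / p := by positivity
  rw [energy_eq, show 2 / p = 1 / p * 2 by ring]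
  nlinarith

theorem energy_nonneg (hN : 3 ≤ N) (hΩb : Bornology.IsBounded Ω) {p : ℝ} (hp : 4 ≤ p)
    (hpP : p ≤ 2 * sobolevExp N) {v : L2Pair Ω} (hv : v ∈ nehari Ω p) : 0 ≤ energy Ω p v := by
  refine le_trans (mul_nonneg ?_ (sq_nonneg _)) (mul_norm_sq_le_energy hN hΩb hp hpP hv)
  rw [sub_nonneg, div_le_div_iff₀ (by linarith) two_pos]
  linarith

theorem bddBelow_energy (hN : 3 ≤ N) (hΩb : Bornology.IsBounded Ω) {p : ℝ} (hp : 4 ≤ p)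
    (hpP : p ≤ 2 * sobolevExp N) : BddBelow (energy Ω p '' nehari Ω p) := by
  refine ⟨0, ?_⟩
  rintro _ ⟨v, hv, rfl⟩
  exact energy_nonneg hN hΩb hp hpP hv

theorem level_le (hN : 3 ≤ N) (hΩb : Bornology.IsBounded Ω) {p : ℝ} (hp : 4 ≤ p)
    (hpP : p ≤ 2 * sobolevExp N) {v : L2Pair Ω} (hv : v ∈ nehari Ω p) :
    level Ω p ≤ energy Ω p v :=
  csInf_le (bddBelow_energy hN hΩb hp hpP) (mem_image_of_mem _ hv)

/-- Intermediate values for ∫ k_p(tv) - t²‖∇v‖² on [a, T]. The bound t ≤ T is what the limit p →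
2·2* needs. -/
theorem exists_smul_mem_nehari_of_le (hN : 3 ≤ N) (hΩb : Bornology.IsBounded Ω) {p : ℝ}
    (hp : 4 < p) (hpP : p ≤ 2 * sobolevExp N) {v : L2Pair Ω} (hv : v ∈ H10 Ω) (hv0 : v.fst ≠ 0)
    {T : ℝ} (hT0 : 0 < T)
    (hT : T ^ 2 * ‖v.snd‖ ^ 2 ≤ ∫ x in Ω, nehariDensity p (T * v.fst x)) :
    ∃ t, 0 < t ∧ t ≤ T ∧ t • v ∈ nehari Ω p := by
  have hp2 : 2 ≤ p := by linarith
  have hA : 0 < ‖v.snd‖ ^ 2 := pow_pos (norm_snd_pos hN hΩb hv hv0) 2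
  have i1 := integrable_nehariDensity hN hΩb hp2 hpP 1 hv
  simp only [one_mul] at i1
  set b := ∫ x in Ω, nehariDensity p (v.fst x) with hb
  -- For small a the density term is at most a² · a^(p/2-2) b, and a^(p/2-2) → 0 since p > 4.
  obtain ⟨a, ha0, haT, ha⟩ : ∃ a, 0 < a ∧ a ≤ T ∧
      ∫ x in Ω, nehariDensity p (a * v.fst x) ≤ a ^ 2 * ‖v.snd‖ ^ 2 := by
    have h1 : Tendsto (fun a : ℝ => a ^ (p / 2 - 2) * b) (𝓝[>] 0) (𝓝 (0 ^ (p / 2 - 2) * b)) :=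
      ((Real.continuousAt_rpow_const 0 _ (Or.inr (by linarith))).tendsto.mono_left
        nhdsWithin_le_nhds).mul_const b
    rw [Real.zero_rpow (by linarith), zero_mul] at h1
    obtain ⟨a, ⟨ha, ha1⟩, ha0⟩ := (((h1.eventually_lt_const hA).and
      (Ioo_mem_nhdsGT (lt_min hT0 one_pos))).and self_mem_nhdsWithin).exists
    refine ⟨a, ha0, (ha1.2.le.trans (min_le_left _ _)), ?_⟩
    have h2 : ∫ x in Ω, nehariDensity p (a * v.fst x) ≤ a ^ (p / 2) * b := by
      rw [hb, ← integral_const_mul]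
      exact integral_mono (integrable_nehariDensity hN hΩb hp2 hpP a hv) (i1.const_mul _)
        fun x => nehariDensity_mul_le hp2 ha0 (ha1.2.le.trans (min_le_right _ _))
    refine h2.trans ?_
    have h3 : a ^ (p / 2) = a ^ 2 * a ^ (p / 2 - 2) := by
      rw [← Real.rpow_two, ← Real.rpow_add ha0]; congr 1; ring
    rw [h3, mul_assoc]
    gcongr
  have hcont : ContinuousOn (fun t => ∫ x in Ω, nehariDensity p (t * v.fst x)) (Icc a T) := by
    refine continuousOn_of_dominated (bound := fun x => nehariDensity p (T * v.fst x))
      (fun t _ => (integrable_nehariDensity hN hΩb hp2 hpP t hv).aestronglyMeasurable)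
      (fun t ht => Eventually.of_forall fun x => ?_)
      (integrable_nehariDensity hN hΩb hp2 hpP T hv) (Eventually.of_forall fun x => ?_)
    · rw [Real.norm_eq_abs, abs_of_nonneg (nehariDensity_nonneg _ _)]
      exact nehariDensity_mul_mono hp2 (ha0.trans_le ht.1) ht.2
    · exact ((continuous_nehariDensity hp2).comp (continuous_mul_const _)).continuousOn
  have hcont2 : ContinuousOn (fun t => (∫ x in Ω, nehariDensity p (t * v.fst x)) -
      t ^ 2 * ‖v.snd‖ ^ 2) (Icc a T) :=
    hcont.sub (by fun_prop)
  obtain ⟨t, ht, ht2⟩ := intermediate_value_Icc haT hcont2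
    (show (0 : ℝ) ∈ Icc _ _ from ⟨by linarith, by linarith⟩)
  have ht0 : 0 < t := ha0.trans_le ht.1
  exact ⟨t, ht0, ht.2, (smul_mem_nehari_iff ht0.ne' hv hv0).2 (sub_eq_zero.1 ht2)⟩

theorem exists_smul_mem_nehari (hN : 3 ≤ N) (hΩb : Bornology.IsBounded Ω) {p : ℝ}
    (hp : 4 < p) (hpP : p ≤ 2 * sobolevExp N) {v : L2Pair Ω} (hv : v ∈ H10 Ω)
    (hv0 : v.fst ≠ 0) : ∃ t : ℝ, 0 < t ∧ t • v ∈ nehari Ω p := by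
  have hp2 : 2 ≤ p := by linarith
  have i1 := integrable_nehariDensity hN hΩb hp2 hpP 1 hv
  simp only [one_mul] at i1
  have hb := integral_nehariDensity_pos hN hΩb hp2 hpP hv hv0
  have h1 : Tendsto (fun t : ℝ => t ^ (p / 2 - 2) * ∫ x in Ω, nehariDensity p (v.fst x)) atTop
      atTop := (tendsto_rpow_atTop (by linarith)).atTop_mul_const hb
  obtain ⟨T, hT, hT1⟩ := ((h1.eventually_ge_atTop (‖v.snd‖ ^ 2)).and
    (eventually_ge_atTop 1)).exists
  have hT0 : 0 < T := by linarith
  obtain ⟨t, ht0, -, ht⟩ := exists_smul_mem_nehari_of_le hN hΩb hp hpP hv hv0 hT0 (by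
    have h2 : T ^ (p / 2) * ∫ x in Ω, nehariDensity p (v.fst x) ≤
        ∫ x in Ω, nehariDensity p (T * v.fst x) := by
      rw [← integral_const_mul]
      exact integral_mono (i1.const_mul _) (integrable_nehariDensity hN hΩb hp2 hpP T hv)
        fun x => rpow_mul_nehariDensity_le hp2 hT1
    refine le_trans ?_ h2
    have h3 : T ^ (p / 2) = T ^ 2 * T ^ (p / 2 - 2) := by
      rw [← Real.rpow_two, ← Real.rpow_add hT0]; congr 1; ring
    rw [h3, mul_assoc]
    gcongr)
  exact ⟨t, ht0, ht⟩

/-! ### Nonemptiness of the Nehari manifolds -/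

theorem exists_mem_H10_fst_ne_zero (hΩo : IsOpen Ω) (hΩn : Ω.Nonempty) :
    ∃ v ∈ H10 Ω, v.fst ≠ 0 := by
  obtain ⟨x₀, hx₀⟩ := hΩn
  obtain ⟨φ, hφs, hφc, hφ, -, hφx⟩ :=
    exists_contDiff_tsupport_subset (n := ⊤) (hΩo.mem_nhds hx₀)
  have hgc : Continuous (gradient φ) :=
    (InnerProductSpace.toDual ℝ (EuclideanSpace ℝ (Fin N))).symm.continuous.comp
      (hφ.continuous_fderiv (by simp))
  have hgs : HasCompactSupport (gradient φ) :=
    hφc.mono' (support_gradient_subset φ)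
  have h1 : MemLp φ 2 (volume.restrict Ω) :=
    (hφ.continuous.memLp_of_hasCompactSupport hφc).restrict Ω
  have h2 : MemLp (gradient φ) 2 (volume.restrict Ω) :=
    (hgc.memLp_of_hasCompactSupport hgs).restrict Ω
  refine ⟨WithLp.toLp 2 (h1.toLp φ, h2.toLp (gradient φ)), ?_, fun h => ?_⟩
  · refine Submodule.le_topologicalClosure _ ?_
    exact ⟨φ, hφ, hφc, hφs, h1.coeFn_toLp, h2.coeFn_toLp⟩
  · have h3 : φ =ᵐ[volume.restrict Ω] (fun _ => (0 : ℝ)) :=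
      h1.coeFn_toLp.symm.trans (Lp.eq_zero_iff_ae_eq_zero.1 h)
    have h4 := Measure.eqOn_open_of_ae_eq h3 hΩo hφ.continuous.continuousOn continuousOn_const
    have := h4 hx₀
    rw [hφx] at this
    exact one_ne_zero this

theorem nehari_nonempty (hN : 3 ≤ N) (hΩo : IsOpen Ω) (hΩn : Ω.Nonempty)
    (hΩb : Bornology.IsBounded Ω) {p : ℝ} (hp : 4 < p) (hpP : p ≤ 2 * sobolevExp N) :
    (nehari Ω p).Nonempty := by
  obtain ⟨v, hv, hv0⟩ := exists_mem_H10_fst_ne_zero hΩo hΩn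
  obtain ⟨t, -, ht⟩ := exists_smul_mem_nehari hN hΩb hp hpP hv hv0
  exact ⟨_, ht⟩

theorem isGLB_level (hN : 3 ≤ N) (hΩo : IsOpen Ω) (hΩn : Ω.Nonempty)
    (hΩb : Bornology.IsBounded Ω) {p : ℝ} (hp : 4 < p) (hpP : p ≤ 2 * sobolevExp N) :
    IsGLB (energy Ω p '' nehari Ω p) (level Ω p) :=
  isGLB_csInf ((nehari_nonempty hN hΩo hΩn hΩb hp hpP).image _)
    (bddBelow_energy hN hΩb hp.le hpP)

/-! ### Attainment of the subcritical levels -/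

/-- The Nehari identity and Sobolev give ‖∇v‖² ≤ C‖∇v‖^(p/2) with p/2 > 2, which excludes small
nonzero gradients. -/
theorem exists_le_norm_snd (hN : 3 ≤ N) (hΩb : Bornology.IsBounded Ω) {p : ℝ} (hp : 4 < p)
    (hpP : p ≤ 2 * sobolevExp N) :
    ∃ δ > 0, ∀ v ∈ nehari Ω p, δ ≤ ‖v.snd‖ := by
  obtain ⟨C, hC0, hC⟩ := exists_sobolev (r := p / 2) hN hΩb (by linarith) (by linarith)
  have h1 : Tendsto (fun a : ℝ => (Real.sqrt 2 ^ (p / 2) * C) * a ^ (p / 2 - 2)) (𝓝[>] 0)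
      (𝓝 ((Real.sqrt 2 ^ (p / 2) * C) * 0 ^ (p / 2 - 2))) :=
    ((Real.continuousAt_rpow_const 0 _ (Or.inr (by linarith))).tendsto.mono_left
      nhdsWithin_le_nhds).const_mul _
  rw [Real.zero_rpow (by linarith), mul_zero] at h1
  obtain ⟨δ, hδ, hδ0⟩ := ((h1.eventually_lt_const one_pos).and self_mem_nhdsWithin).exists
  refine ⟨δ, hδ0, fun v hv => ?_⟩
  obtain ⟨hvH, hv0, hvK⟩ := mem_nehari_iff.1 hv
  have hpos := norm_snd_pos hN hΩb hvH hv0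
  by_contra! hlt
  have i3 := integrable_nehariDensity hN hΩb (by linarith) hpP 1 hvH
  simp only [one_mul] at i3
  have h2 : ‖v.snd‖ ^ 2 ≤ Real.sqrt 2 ^ (p / 2) * (C * ‖v.snd‖ ^ (p / 2)) := by
    rw [← hvK]
    calc ∫ x in Ω, nehariDensity p (v.fst x)
        ≤ ∫ x in Ω, Real.sqrt 2 ^ (p / 2) * |v.fst x| ^ (p / 2) :=
          integral_mono i3 ((hC v hvH).1.const_mul _) fun x =>
            (nehariDensity_le (by linarith) _).trans (abs_change_rpow_le (by linarith) _)
      _ ≤ _ := by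
          rw [integral_const_mul]
          exact mul_le_mul_of_nonneg_left (hC v hvH).2 (by positivity)
  have h3 : ‖v.snd‖ ^ (p / 2) = ‖v.snd‖ ^ (p / 2 - 2) * ‖v.snd‖ ^ 2 := by
    rw [← Real.rpow_two, ← Real.rpow_add hpos]; congr 1; ring
  have h4 : ‖v.snd‖ ^ (p / 2 - 2) ≤ δ ^ (p / 2 - 2) :=
    Real.rpow_le_rpow hpos.le hlt.le (by linarith)
  have h5 : Real.sqrt 2 ^ (p / 2) * C * ‖v.snd‖ ^ (p / 2 - 2) < 1 :=
    (mul_le_mul_of_nonneg_left h4 (by positivity)).trans_lt hδ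
  rw [h3] at h2
  nlinarith [pow_pos hpos 2]

/-- The integrand grows like |s|^(p/2) with p/2 < 2*, while the sequence is bounded in L^(2*). In
the existence of minimizers, the strict inequality p < 2·2* serves only here. -/
theorem tendsto_integral_abs_change_rpow (hN : 3 ≤ N) (hΩb : Bornology.IsBounded Ω) {p : ℝ}
    (hp : 0 < p) (hpP : p < 2 * sobolevExp N) (t : ℝ) {w : ℕ → L2Pair Ω} {u : L2Pair Ω}
    (hw : ∀ n, w n ∈ H10 Ω) (hu : u ∈ H10 Ω) {M : ℝ} (hM : ∀ n, ‖(w n).snd‖ ≤ M)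
    (hlim : ∀ᵐ x ∂(volume.restrict Ω), Tendsto (fun n => (w n).fst x) atTop (𝓝 (u.fst x))) :
    Tendsto (fun n => ∫ x in Ω, |change (t * (w n).fst x)| ^ p) atTop
      (𝓝 (∫ x in Ω, |change (t * u.fst x)| ^ p)) := by
  have := isFiniteMeasure_of_isBounded hΩb
  have hq := two_lt_sobolevExp hN
  obtain ⟨C, hC0, hC⟩ := exists_sobolev hN hΩb (by linarith) (le_refl (sobolevExp N))
  refine tendsto_integral_of_subcritical (G := fun s => |change (t * s)| ^ p)
    (c := Real.sqrt 2 ^ (p / 2) * |t| ^ (p / 2)) (r := p / 2) (q := sobolevExp N)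
    (L := C * M ^ sobolevExp N)
    ((continuous_abs_change_rpow hp.le).comp (continuous_const_mul t)) (by positivity)
    (by positivity) (by linarith) (fun s => ?_) (fun n => Lp.aestronglyMeasurable _)
    (Lp.aestronglyMeasurable _) (fun n => (hC _ (hw n)).1) (hC _ hu).1
    (fun n => (hC _ (hw n)).2.trans ?_) hlim
  · rw [abs_of_nonneg (by positivity), mul_assoc, ← Real.mul_rpow (abs_nonneg _) (abs_nonneg _),
      ← abs_mul]
    exact abs_change_rpow_le hp.le _
  · gcongr
    exact hM n

theorem exists_energy_eq_level (hN : 3 ≤ N) (hΩo : IsOpen Ω) (hΩn : Ω.Nonempty)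
    (hΩb : Bornology.IsBounded Ω) {p : ℝ} (hp : 4 < p) (hpP : p < 2 * sobolevExp N) :
    ∃ v ∈ nehari Ω p, energy Ω p v = level Ω p := by
  obtain ⟨e, he, hlim, hmem⟩ := exists_seq_tendsto_sInf
    ((nehari_nonempty hN hΩo hΩn hΩb hp hpP.le).image (energy Ω p))
    (bddBelow_energy hN hΩb hp.le hpP.le)
  choose w hw hwe using hmem
  have hc : 0 < 1 / 2 - 2 / p := by
    rw [sub_pos, div_lt_div_iff₀ (by linarith) two_pos]; linarith
  obtain ⟨M, hM⟩ : ∃ M : ℝ, ∀ n, ‖(w n).snd‖ ≤ M := by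
    refine ⟨e 0 / (1 / 2 - 2 / p) + 1, fun n => ?_⟩
    have h1 := mul_norm_sq_le_energy hN hΩb hp.le hpP.le (hw n)
    rw [hwe] at h1
    have h2 : ‖(w n).snd‖ ^ 2 ≤ e 0 / (1 / 2 - 2 / p) := by
      rw [le_div_iff₀ hc, mul_comm]
      exact h1.trans (he n.zero_le)
    nlinarith [sq_nonneg (‖(w n).snd‖ - 1)]
  obtain ⟨u, hu, ns, hns, hweak, hae⟩ := exists_subseq_tendsto hN hΩb (fun n => (hw n).1) hM
  have hconv := fun t => tendsto_integral_abs_change_rpow hN hΩb (by linarith) hpP t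
    (fun n => (hw (ns n)).1) hu (fun n => hM (ns n)) hae
  have hu0 : u.fst ≠ 0 := by
    intro h0
    obtain ⟨δ, hδ0, hδ⟩ := exists_le_norm_snd hN hΩb hp hpP.le
    have h1 := hconv 1
    have h2 : ∫ x in Ω, |change (1 * u.fst x)| ^ p = 0 := by
      refine integral_eq_zero_of_ae ?_
      filter_upwards [Lp.eq_zero_iff_ae_eq_zero.1 h0] with x hx
      simp only [one_mul, hx, Pi.zero_apply, change_zero, abs_zero]
      exact Real.zero_rpow (by linarith)
    rw [h2] at h1
    have h3 : δ ^ 2 ≤ 0 := by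
      refine ge_of_tendsto' h1 fun n => ?_
      obtain ⟨hH, -, hK⟩ := mem_nehari_iff.1 (hw (ns n))
      have h4 : δ ^ 2 ≤ ‖(w (ns n)).snd‖ ^ 2 := by
        gcongr
        exact hδ _ (hw _)
      refine h4.trans ?_
      rw [← hK]
      simp only [one_mul]
      have i1 := integrable_abs_change_rpow hN hΩb (by linarith) hpP.le 1 hH
      have i3 := integrable_nehariDensity hN hΩb (by linarith) hpP.le 1 hH
      simp only [one_mul] at i1 i3
      exact integral_mono i3 i1 fun x => nehariDensity_le (by linarith) _
    nlinarith
  obtain ⟨t, ht0, ht⟩ := exists_smul_mem_nehari hN hΩb hp hpP.le hu hu0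
  refine ⟨t • u, ht, le_antisymm ?_ (level_le hN hΩb hp.le hpP.le ht)⟩
  -- Weak lower semicontinuity by hand: 2⟨∇w_n, ∇u⟩ - ‖∇u‖² ≤ ‖∇w_n‖², and the left side converges
  -- to ‖∇u‖².
  have hlower : Tendsto (fun n => t ^ 2 * inner ℝ (w (ns n)).snd u.snd -
      1 / 2 * (t ^ 2 * ‖u.snd‖ ^ 2) - 1 / p * ∫ x in Ω, |change (t * (w (ns n)).fst x)| ^ p)
      atTop (𝓝 (energy Ω p (t • u))) := by
    have h := (((hweak u.snd).const_mul (t ^ 2)).sub_const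
      (1 / 2 * (t ^ 2 * ‖u.snd‖ ^ 2))).sub ((hconv t).const_mul (1 / p))
    rw [energy_smul]
    convert h using 2
    rw [real_inner_self_eq_norm_sq]
    ring
  refine le_of_tendsto_of_tendsto' hlower (hlim.comp hns.tendsto_atTop) fun n => ?_
  rw [Function.comp_apply, ← hwe]
  -- Each w_n lies on the Nehari manifold, so its energy bounds that of t w_n for the t fixed by u.
  -- The limit u itself need not lie on the manifold.
  refine le_trans ?_ (energy_smul_le hN hΩb hp.le hpP.le (hw (ns n)) ht0.le)
  rw [energy_smul]
  have h1 : 2 * inner ℝ (w (ns n)).snd u.snd ≤ ‖(w (ns n)).snd‖ ^ 2 + ‖u.snd‖ ^ 2 := by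
    have := norm_sub_sq_real (w (ns n)).snd u.snd
    nlinarith [sq_nonneg ‖(w (ns n)).snd - u.snd‖]
  nlinarith [mul_le_mul_of_nonneg_left h1 (sq_nonneg t)]

theorem isLeast_level (hN : 3 ≤ N) (hΩo : IsOpen Ω) (hΩn : Ω.Nonempty)
    (hΩb : Bornology.IsBounded Ω) {p : ℝ} (hp : 4 < p) (hpP : p < 2 * sobolevExp N) :
    IsLeast (energy Ω p '' nehari Ω p) (level Ω p) :=
  ⟨exists_energy_eq_level hN hΩo hΩn hΩb hp hpP,
    (isGLB_level hN hΩo hΩn hΩb hp hpP.le).1⟩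

/-! ### The limit of the levels -/

theorem level_critical_le (hN : 3 ≤ N) (hΩo : IsOpen Ω) (hΩn : Ω.Nonempty)
    (hΩb : Bornology.IsBounded Ω) {p : ℝ} (hp : 4 < p) (hpP : p ≤ 2 * sobolevExp N) :
    level Ω (2 * sobolevExp N) ≤
      level Ω p + (1 / p - 1 / (2 * sobolevExp N)) * (volume.restrict Ω).real univ := by
  have := isFiniteMeasure_of_isBounded hΩb
  rw [← sub_le_iff_le_add]
  refine le_csInf ((nehari_nonempty hN hΩo hΩn hΩb hp hpP).image _) ?_
  rintro _ ⟨v, hv, rfl⟩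
  obtain ⟨hvH, hv0, -⟩ := mem_nehari_iff.1 hv
  obtain ⟨t, ht0, ht⟩ := exists_smul_mem_nehari hN hΩb (hp.trans_le hpP) le_rfl hvH hv0
  have h1 := level_le hN hΩb (hp.le.trans hpP) le_rfl ht
  have h2 := energy_smul_le hN hΩb hp.le hpP hv ht0.le
  have i1 := integrable_abs_change_rpow hN hΩb (by linarith) hpP t hvH
  have i2 := integrable_abs_change_rpow hN hΩb (by linarith) (le_refl (2 * sobolevExp N)) t hvH
  have h3 := integral_mono ((i1.const_mul (1 / p)).sub (i2.const_mul (1 / (2 * sobolevExp N))))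
    (integrable_const (1 / p - 1 / (2 * sobolevExp N))) fun x =>
      rpow_div_sub_le (abs_nonneg (change (t * v.fst x))) (by linarith) hpP
  simp only [Pi.sub_apply] at h3
  rw [integral_sub (i1.const_mul _) (i2.const_mul _), integral_const_mul, integral_const_mul,
    integral_const, smul_eq_mul] at h3
  rw [energy_smul] at h1 h2
  linarith

theorem tendsto_integral_nehariDensity_critical (hN : 3 ≤ N) (hΩb : Bornology.IsBounded Ω)
    {v : L2Pair Ω} (hv : v ∈ H10 Ω) (t : ℝ) :
    Tendsto (fun p => ∫ x in Ω, nehariDensity p (t * v.fst x)) (𝓝[<] (2 * sobolevExp N))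
      (𝓝 (∫ x in Ω, nehariDensity (2 * sobolevExp N) (t * v.fst x))) := by
  have := isFiniteMeasure_of_isBounded hΩb
  have hq := two_lt_sobolevExp hN
  have hev : ∀ᶠ p in 𝓝[<] (2 * sobolevExp N), p ∈ Ioo 4 (2 * sobolevExp N) :=
    Ioo_mem_nhdsLT (by linarith)
  refine tendsto_integral_filter_of_dominated_convergence
    (fun x => 1 + |change (t * v.fst x)| ^ (2 * sobolevExp N))
    (hev.mono fun p hp => (integrable_nehariDensity hN hΩb (by linarith [hp.1]) hp.2.le t
      hv).aestronglyMeasurable)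
    (hev.mono fun p hp => Eventually.of_forall fun x => ?_)
    ((integrable_const 1).add (integrable_abs_change_rpow hN hΩb (by linarith) le_rfl t hv))
    (Eventually.of_forall fun x => ?_)
  · rw [Real.norm_eq_abs, abs_of_nonneg (nehariDensity_nonneg _ _)]
    exact (nehariDensity_le (by linarith [hp.1]) _).trans
      (rpow_le_one_add_rpow (abs_nonneg _) (by linarith [hp.1]) hp.2.le)
  · have h : ContinuousAt (fun p => nehariDensity p (t * v.fst x)) (2 * sobolevExp N) := by
      have h1 : ContinuousAt (fun p : ℝ => |change (t * v.fst x)| ^ (p - 2)) (2 * sobolevExp N) :=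
        ContinuousAt.comp (f := fun p : ℝ => p - 2)
          (Real.continuousAt_const_rpow' (by linarith)) (by fun_prop)
      exact ((h1.mul continuousAt_const).mul continuousAt_const).mul continuousAt_const
    exact h.tendsto.mono_left nhdsWithin_le_nhds

theorem tendsto_integral_rpow_sub_critical (hN : 3 ≤ N) (hΩb : Bornology.IsBounded Ω)
    {v : L2Pair Ω} (hv : v ∈ H10 Ω) (t : ℝ) :
    Tendsto (fun p => ∫ x in Ω, |1 / (2 * sobolevExp N) * |change (t * v.fst x)| ^ (2 * sobolevExp N)
      - 1 / p * |change (t * v.fst x)| ^ p|) (𝓝[<] (2 * sobolevExp N)) (𝓝 0) := by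
  have := isFiniteMeasure_of_isBounded hΩb
  have hq := two_lt_sobolevExp hN
  have hev : ∀ᶠ p in 𝓝[<] (2 * sobolevExp N), p ∈ Ioo 4 (2 * sobolevExp N) :=
    Ioo_mem_nhdsLT (by linarith)
  have i2 := integrable_abs_change_rpow hN hΩb (by linarith) (le_refl (2 * sobolevExp N)) t hv
  rw [← integral_zero (EuclideanSpace ℝ (Fin N)) ℝ (μ := volume.restrict Ω)]
  refine tendsto_integral_filter_of_dominated_convergence
    (fun x => |change (t * v.fst x)| ^ (2 * sobolevExp N) +
      (1 + |change (t * v.fst x)| ^ (2 * sobolevExp N)))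
    (hev.mono fun p hp => ?_)
    (hev.mono fun p hp => Eventually.of_forall fun x => ?_)
    (i2.add ((integrable_const 1).add i2))
    (Eventually.of_forall fun x => ?_)
  · exact ((i2.const_mul _).sub ((integrable_abs_change_rpow hN hΩb (by linarith [hp.1]) hp.2.le t
      hv).const_mul _)).abs.aestronglyMeasurable
  · rw [Real.norm_eq_abs, abs_abs]
    have h1 := rpow_le_one_add_rpow (abs_nonneg (change (t * v.fst x))) (by linarith [hp.1])
      hp.2.le
    have h2 : 0 ≤ |change (t * v.fst x)| ^ p := by positivity
    have h3 : 0 ≤ |change (t * v.fst x)| ^ (2 * sobolevExp N) := by positivity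
    have h4 : 1 / p ≤ 1 := by rw [div_le_one (by linarith [hp.1])]; linarith [hp.1]
    have h5 : 1 / (2 * sobolevExp N) ≤ 1 := by rw [div_le_one (by linarith)]; linarith
    have h6 : 0 ≤ 1 / p := by have := hp.1; positivity
    have h7 : 0 ≤ 1 / (2 * sobolevExp N) := by positivity
    refine (abs_sub _ _).trans ?_
    rw [abs_of_nonneg (mul_nonneg h7 h3), abs_of_nonneg (mul_nonneg h6 h2)]
    nlinarith
  · have h : ContinuousAt (fun p => |1 / (2 * sobolevExp N) *
        |change (t * v.fst x)| ^ (2 * sobolevExp N) - 1 / p * |change (t * v.fst x)| ^ p|)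
        (2 * sobolevExp N) := by
      refine (continuousAt_const.sub (ContinuousAt.mul ?_
        (Real.continuousAt_const_rpow' (by linarith)))).abs
      exact continuousAt_const.div continuousAt_id (by linarith)
    have h2 := h.tendsto.mono_left (nhdsWithin_le_nhds (s := Iio (2 * sobolevExp N)))
    rwa [sub_self, abs_zero] at h2

theorem eventually_level_lt (hN : 3 ≤ N) (hΩb : Bornology.IsBounded Ω) {v : L2Pair Ω}
    (hv : v ∈ nehari Ω (2 * sobolevExp N)) {ε : ℝ} (hε : 0 < ε) :
    ∀ᶠ p in 𝓝[<] (2 * sobolevExp N), level Ω p < energy Ω (2 * sobolevExp N) v + ε := by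
  have hq := two_lt_sobolevExp hN
  obtain ⟨hvH, hv0, hvK⟩ := mem_nehari_iff.1 hv
  have hA : 0 < ‖v.snd‖ ^ 2 := pow_pos (norm_snd_pos hN hΩb hvH hv0) 2
  have hev : ∀ᶠ p in 𝓝[<] (2 * sobolevExp N), p ∈ Ioo 4 (2 * sobolevExp N) :=
    Ioo_mem_nhdsLT (by linarith)
  -- Here 2^(2*) > 2² as 2* > 2. The strict inequality persists for p near 2·2*, so N_p meets the
  -- ray of v at some t ≤ 2; any factor above 1 would do in place of 2.
  have hK2 : 2 ^ 2 * ‖v.snd‖ ^ 2 <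
      ∫ x in Ω, nehariDensity (2 * sobolevExp N) (2 * v.fst x) := by
    have i1 := integrable_nehariDensity hN hΩb (by linarith) (le_refl (2 * sobolevExp N)) 1 hvH
    simp only [one_mul] at i1
    have h1 := integral_mono (i1.const_mul (2 ^ (2 * sobolevExp N / 2)))
      (integrable_nehariDensity hN hΩb (by linarith) (le_refl (2 * sobolevExp N)) 2 hvH)
      fun x => rpow_mul_nehariDensity_le (by linarith) one_le_two
    rw [integral_const_mul, hvK, mul_div_cancel_left₀ _ two_ne_zero] at h1
    have h2 : (2 : ℝ) ^ (2 : ℝ) < 2 ^ sobolevExp N :=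
      Real.rpow_lt_rpow_of_exponent_lt one_lt_two hq
    rw [Real.rpow_two] at h2
    exact (mul_lt_mul_of_pos_right h2 hA).trans_le h1
  filter_upwards [hev,
    (tendsto_integral_nehariDensity_critical hN hΩb hvH 2).eventually_const_lt hK2,
    (tendsto_integral_rpow_sub_critical hN hΩb hvH 2).eventually_lt_const hε] with p hp hKp hJ
  obtain ⟨t, ht0, ht2, ht⟩ :=
    exists_smul_mem_nehari_of_le hN hΩb hp.1 hp.2.le hvH hv0 two_pos hKp.le
  have h1 := level_le hN hΩb hp.1.le hp.2.le ht
  have h2 := energy_smul_le hN hΩb (by linarith) le_rfl hv ht0.le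
  have i1 := fun s => integrable_abs_change_rpow hN hΩb (by linarith [hp.1]) hp.2.le s hvH
  have i2 := fun s => integrable_abs_change_rpow hN hΩb (by linarith)
    (le_refl (2 * sobolevExp N)) s hvH
  have h3 := integral_mono
    (((i2 t).const_mul (1 / (2 * sobolevExp N))).sub ((i1 t).const_mul (1 / p)))
    (((i2 2).const_mul (1 / (2 * sobolevExp N))).sub ((i1 2).const_mul (1 / p))).abs fun x =>
      rpow_div_sub_le_abs (abs_nonneg (change (t * v.fst x)))
        (h := |change (2 * v.fst x)|) (by
          rw [abs_change, abs_change]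
          refine strictMono_change.monotone ?_
          rw [abs_mul, abs_mul, abs_of_pos ht0, abs_two]
          gcongr) (by linarith [hp.1]) hp.2.le
  simp only [Pi.sub_apply] at h3
  rw [integral_sub ((i2 t).const_mul _) ((i1 t).const_mul _), integral_const_mul,
    integral_const_mul] at h3
  rw [energy_smul] at h1 h2
  linarith

theorem tendsto_level (hN : 3 ≤ N) (hΩo : IsOpen Ω) (hΩn : Ω.Nonempty)
    (hΩb : Bornology.IsBounded Ω) :
    Tendsto (fun p => level Ω p) (𝓝[<] (2 * sobolevExp N)) (𝓝 (level Ω (2 * sobolevExp N))) := by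
  have hq := two_lt_sobolevExp hN
  have hev : ∀ᶠ p in 𝓝[<] (2 * sobolevExp N), p ∈ Ioo 4 (2 * sobolevExp N) :=
    Ioo_mem_nhdsLT (by linarith)
  refine tendsto_order.2 ⟨fun a ha => ?_, fun a ha => ?_⟩
  · have h1 : Tendsto (fun p : ℝ => level Ω (2 * sobolevExp N) -
        (1 / p - 1 / (2 * sobolevExp N)) * (volume.restrict Ω).real univ)
        (𝓝[<] (2 * sobolevExp N)) (𝓝 (level Ω (2 * sobolevExp N) -
        (1 / (2 * sobolevExp N) - 1 / (2 * sobolevExp N)) * (volume.restrict Ω).real univ)) := by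
      refine Tendsto.mono_left ?_ nhdsWithin_le_nhds
      refine tendsto_const_nhds.sub (((Tendsto.div tendsto_const_nhds tendsto_id
        (by linarith)).sub_const _).mul_const _)
    rw [sub_self, zero_mul, sub_zero] at h1
    filter_upwards [hev, h1.eventually_const_lt ha] with p hp h
    have := level_critical_le hN hΩo hΩn hΩb hp.1 hp.2.le
    linarith
  · obtain ⟨_, ⟨v, hv, rfl⟩, hva⟩ := exists_lt_of_csInf_lt
      ((nehari_nonempty hN hΩo hΩn hΩb (by linarith) (le_refl (2 * sobolevExp N))).image _) ha
    filter_upwards [eventually_level_lt hN hΩb hv (sub_pos.2 hva)] with p hp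
    linarith

end QuasilinearNehari
end

theorem theorem3p9 (N : ℕ) (hN : 3 ≤ N) (Ω : Set (EuclideanSpace ℝ (Fin N)))
    (hΩo : IsOpen Ω) (hΩc : IsConnected Ω) (hΩb : Bornology.IsBounded Ω) :
    (∀ p ∈ Set.Ioo (4 : ℝ) (2 * QuasilinearNehari.sobolevExp N),
      IsLeast (QuasilinearNehari.energy Ω p '' QuasilinearNehari.nehari Ω p)
        (QuasilinearNehari.level Ω p)) ∧
    IsGLB (QuasilinearNehari.energy Ω (2 * QuasilinearNehari.sobolevExp N) ''
        QuasilinearNehari.nehari Ω (2 * QuasilinearNehari.sobolevExp N))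
      (QuasilinearNehari.level Ω (2 * QuasilinearNehari.sobolevExp N)) ∧
    Filter.Tendsto (fun p : ℝ => QuasilinearNehari.level Ω p)
      (nhdsWithin (2 * QuasilinearNehari.sobolevExp N)
        (Set.Iio (2 * QuasilinearNehari.sobolevExp N)))
      (nhds (QuasilinearNehari.level Ω (2 * QuasilinearNehari.sobolevExp N))) :=
  ⟨fun _ hp => QuasilinearNehari.isLeast_level hN hΩo hΩc.nonempty hΩb hp.1 hp.2,
    QuasilinearNehari.isGLB_level hN hΩo hΩc.nonempty hΩb
      (by linarith [QuasilinearNehari.two_lt_sobolevExp hN]) le_rfl,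
    QuasilinearNehari.tendsto_level hN hΩo hΩc.nonempty hΩb⟩
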